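/- Let $\mathcal T=(T,E)$ be an infinite locally finite tree with root $\phi$ and conductances $W_{i,j}=W_{j,i}>0$ for $i\sim j$, $W_{i,j}=0$ otherwise. For $x\in T$ let $|x|=d(\phi,x)$; let $T^{(n)}=\{|x|\le n\}$ and $D^{(n)}=\{|x|=n\}$; let $\Omega$ be the set of ends (infinite self-avoiding paths $\omega=(\omega_k)_{k\ge0}$ with $\omega_0=\phi$), with the Borel $\sigma$-algebra of the end topology, $\Omega_x$ the set of ends whose path crosses $x$, and $x\wedge y$ the closest common ancestor of $x$ and $y$. Let $\beta\in\mathcal D_T^W$, i.e. $\beta\in\mathbb R^T$ and, for $H_\beta=2\beta-W$, every finite block $(H_\beta)_{U,U}$ is positive definite. Let $\hat G^{(n)}=((H_\beta)_{T^{(n)},T^{(n)}})^{-1}$, extended by $0$, and let $\psi^{(n)}$ be the function with $H_\beta\psi^{(n)}=0$ on $T^{(n)}$ and $\psi^{(n)}=1$ off $T^{(n)}$. Assume that $\beta$ is such that the limits $\hat G(i,j)=\lim_n\hat G^{(n)}(i,j)$ and $\psi(i)=\lim_n\psi^{(n)}(i)$ exist in $\mathbb R$ for all $i,j\in T$. For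 a transient nearest-neighbour walk or jump process on $\mathcal T$ with successively visited sites $(X_k)$, the exit (harmonic) measure from $i$ is the law on $\Omega$ of $X_\infty=\lim_k X_k$ when $X_0=i$. Let $\mu^\psi_i$ be the exit measure from $i$ of the random walk with conductances $W_{i,j}\psi(i)\psi(j)$ if $\psi>0$ and this walk is transient, and the null measure otherwise; let $\chi(i,\cdot)=\psi(i)\mu_i^\psi$. Fix $m\ge0$, and let $B_m=\{\delta_x:x\in D^{(m)}\}$. Define the $B_m\times B_m$ matrix $\check C_m$ by $(\check C_m)_{\delta_x,\delta_x}=0$ and $$(\check C_m)_{\delta_x,\delta_{x'}}=\frac{\chi(x\wedge x',\Omega_x)\,\chi(x\wedge x',\Omega_{x'})}{\hat G(x\wedge x',x\wedge x')}\qquad(x\ne x').$$ Let $\rho_m\in\mathbb R^{B_m}$ be such that $2\rho_m-\check C_m$ is positive definite, let $\check G_m=(2\rho_m-\check C_m)^{-1}$, and let $\check g_m(\omega,\tau)=\check G_m(\delta_x,\delta_{x'})$ for $\omega\in\Omega_x$, $\tau\in\Omega_{x'}$, $x,x'\in D^{(m)}$. Let $$G_m(i,j)=\hat G(i,j)+\int_{\Omega^2}\chi(i,d\omega)\,\check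 g_m(\omega,\tau)\,\chi(j,d\tau).$$ Suppose that the Markov jump process with jump rates $\frac12W_{i,j}\frac{G_m(\phi,j)}{G_m(\phi,i)}$ from $i$ to $j$ is transient, and let $\mu_\phi^{\beta,\rho_m,\phi}$ be its exit measure from $\phi$. Then $\check g_m$ is integrable with respect to $\chi(\phi,\cdot)\otimes\chi(\phi,\cdot)$, its integral over $\Omega^2$ is positive, and for every $x\in T$ $$\mu_\phi^{\beta,\rho_m,\phi}(\Omega_x)=\frac{\int_{\Omega\times\Omega_x}\chi(\phi,d\omega)\,\check g_m(\omega,\tau)\,\chi(\phi,d\tau)}{\int_{\Omega^2}\chi(\phi,d\omega)\,\check g_m(\omega,\tau)\,\chi(\phi,d\tau)}.$$ -/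

import Mathlib

open MeasureTheory ProbabilityTheory Filter Topology

noncomputable section

namespace VRJPTree

/-! ### Conductances and Schrödinger operators -/

/-- `W` is a family of positive conductances on the edges of `G`, written as a symmetric function on
pairs of vertices that vanishes off the edges. -/
structure IsConductance {V : Type*} (G : SimpleGraph V) (W : V → V → ℝ) : Prop where
  symm : ∀ i j, W i j = W j i
  pos : ∀ i j, G.Adj i j → 0 < W i j
  zero : ∀ i j, ¬ G.Adj i j → W i j = 0

/-- The matrix `H_β = 2β - W` on an index set `ι`. -/
def schrodinger {ι : Type*} [DecidableEq ι] (W : ι → ι → ℝ) (β : ι → ℝ) : Matrix ι ι ℝ :=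
  Matrix.diagonal (fun i => 2 * β i) - Matrix.of W

/-- The finite block `(H_β)_{U,U}`. -/
def schrodingerBlock {V : Type*} [DecidableEq V] (W : V → V → ℝ) (β : V → ℝ) (U : Finset V) :
    Matrix U U ℝ :=
  (schrodinger W β).submatrix Subtype.val Subtype.val

/-- The set `𝒟_V^W` of the potentials `β` all of whose finite blocks `(H_β)_{U,U}` are positive
definite. -/
def potentials {V : Type*} [DecidableEq V] (W : V → V → ℝ) : Set (V → ℝ) :=
  {β | ∀ U : Finset V, (schrodingerBlock W β U).PosDef}

/-! ### The rooted tree: generations, branches, ends -/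

section Tree

variable {V : Type*} (G : SimpleGraph V) (φ : V)

/-- `x` lies on the geodesic `[φ, y]`, that is, `y` belongs to the branch `T_x`. -/
def IsAncestor (x y : V) : Prop := G.dist φ x + G.dist x y = G.dist φ y

/-- The closest common ancestor `x ∧ y`: the vertex of largest depth on both `[φ, x]` and `[φ, y]`. -/
def meet (x y : V) : V :=
  @Classical.epsilon V ⟨φ⟩ fun z => IsAncestor G φ z x ∧ IsAncestor G φ z y ∧
    ∀ w, IsAncestor G φ w x → IsAncestor G φ w y → G.dist φ w ≤ G.dist φ z

/-- `T^{(n)}`: the vertices at distance at most `n` from `φ`, as a finite set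
(see `mem_ball_iff`). -/
def ball [DecidableEq V] [G.LocallyFinite] : ℕ → Finset V
  | 0 => {φ}
  | n + 1 => ball n ∪ (ball n).biUnion fun x => G.neighborFinset x

theorem mem_ball_iff [DecidableEq V] [G.LocallyFinite] (hG : G.Connected) (n : ℕ) (x : V) :
    x ∈ ball G φ n ↔ G.dist φ x ≤ n := by
  induction n generalizing x with
  | zero => simp [ball, hG.dist_eq_zero_iff, eq_comm]
  | succ n ih =>
    simp only [ball, Finset.mem_union, Finset.mem_biUnion, ih, SimpleGraph.mem_neighborFinset]
    constructor
    · rintro (h | ⟨y, hy, hyx⟩)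
      · omega
      · have h1 := hG.dist_triangle (u := φ) (v := y) (w := x)
        have h2 := SimpleGraph.dist_eq_one_iff_adj.2 hyx
        omega
    · intro h
      by_cases h' : G.dist φ x ≤ n
      · exact Or.inl h'
      · right
        obtain ⟨p, hp⟩ := hG.exists_walk_length_eq_dist x φ
        rw [SimpleGraph.dist_comm] at hp
        cases p with
        | nil => simp at h'
        | @cons _ y _ hxy q =>
          refine ⟨y, ?_, hxy.symm⟩
          have h3 := SimpleGraph.dist_le q
          rw [SimpleGraph.dist_comm] at h3
          simp at hp
          omega

/-- The `n`-th generation `D^{(n)}`. The boundary point `δ_x` is represented by `x`, so that this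
is also the boundary set `B_n`. -/
def generation [DecidableEq V] [G.LocallyFinite] (n : ℕ) : Finset V :=
  (ball G φ n).filter fun x => G.dist φ x = n

/-- The set `Ω` of ends: the infinite self-avoiding paths started at `φ`. Its σ-algebra is the one
generated by the coordinates, which is the Borel σ-algebra of the end topology. -/
abbrev Ends : Type _ :=
  {ω : ℕ → V // ω 0 = φ ∧ (∀ k, G.Adj (ω k) (ω (k + 1))) ∧ Function.Injective ω}

variable {G φ} in
/-- `Ω_x`: the rays that cross `x`. -/
def endsThrough (x : V) : Set (Ends G φ) := {ω | ∃ k, ω.1 k = x}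

variable {G φ} in
/-- The sequence `X` of vertices converges to `ω` in the end topology. -/
def ConvergesToEnd (X : ℕ → V) (ω : Ends G φ) : Prop :=
  ∀ k, ∀ᶠ n in atTop, IsAncestor G φ (ω.1 k) (X n)

end Tree

/-! ### Markov jump processes -/

section Jump

variable {V : Type*}

/-- The law of the next site after `i` when the jump rate from `i` to `j` is `r i j`: it is
proportional to `r i j`, and `i` is absorbing if the total rate out of `i` is zero (or
infinite, which does not occur on a locally finite graph). -/
def jumpPMF (r : V → V → ℝ) (i : V) : PMF V :=
  open scoped Classical in
  if h : (∑' j, ENNReal.ofReal (r i j)) ≠ 0 ∧ (∑' j, ENNReal.ofReal (r i j)) ≠ ⊤ then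
    PMF.normalize (fun j => ENNReal.ofReal (r i j)) h.1 h.2
  else PMF.pure i

variable [MeasurableSpace V] [DiscreteMeasurableSpace V]

def jumpKernel (r : V → V → ℝ) : Kernel V V where
  toFun i := (jumpPMF r i).toMeasure
  measurable' := .of_discrete

instance (r : V → V → ℝ) : IsMarkovKernel (jumpKernel r) :=
  ⟨fun i => PMF.toMeasure.isProbabilityMeasure (jumpPMF r i)⟩

/-- The law, on `V^ℕ`, of the sequence `(X_k)` of the sites successively visited by the Markov jump
process with rates `r` started at `x`. -/
def chainLaw (r : V → V → ℝ) (x : V) : Measure (ℕ → V) :=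
  Kernel.traj (X := fun _ : ℕ => V)
    (fun n => (jumpKernel r).comap (fun h : (i : Finset.Iic n) → V => h ⟨n, by simp⟩)
      (measurable_pi_apply _)) 0 (fun _ => x)

/-- Transience: the Green function `g(x,y) = ∑ₖ P_x[X_k = y]` is finite. -/
def IsTransient (r : V → V → ℝ) : Prop :=
  ∀ x y, ∑' k : ℕ, chainLaw r x {X | X k = y} ≠ ⊤

/-- The exit measure (harmonic measure) from `x`: the distribution on `Ω` of the limit `X_∞` of the
trajectory started at `x`, on the event that this limit exists. The limiting end depends only on the
sites successively visited, not on the holding times. -/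
def exitMeasure (G : SimpleGraph V) (φ : V) (r : V → V → ℝ) (x : V) : Measure (Ends G φ) :=
  Measure.map
    (fun X : {X : ℕ → V // ∃ ω : Ends G φ, ConvergesToEnd X ω} => X.2.choose)
    (Measure.comap Subtype.val (chainLaw r x))

end Jump

/-! ### The environment associated with `G_m` -/

section Environment

variable {V : Type*} [DecidableEq V] (G : SimpleGraph V) [G.LocallyFinite] (φ : V)
  (W : V → V → ℝ) (β : V → ℝ)

/-- `Ĝ^{(n)}`: the inverse of `(H_β)_{T^{(n)},T^{(n)}}`, extended by `0`. -/
def greenN (n : ℕ) (i j : V) : ℝ :=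
  if h : i ∈ ball G φ n ∧ j ∈ ball G φ n then
    (schrodingerBlock W β (ball G φ n))⁻¹ ⟨i, h.1⟩ ⟨j, h.2⟩
  else 0

/-- `η^{(n)}_i`: the total conductance from `i` to the complement of `T^{(n)}`. -/
def etaN (n : ℕ) (i : V) : ℝ :=
  ∑ j ∈ (G.neighborFinset i).filter (fun j => j ∉ ball G φ n), W i j

/-- `ψ^{(n)}`: the solution of `H_β ψ^{(n)} = 0` on `T^{(n)}` equal to `1` off `T^{(n)}`, that is,
`ψ^{(n)} = Ĝ^{(n)} η^{(n)}` on `T^{(n)}`. -/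
def psiN (n : ℕ) (i : V) : ℝ :=
  if i ∈ ball G φ n then ∑ j ∈ ball G φ n, greenN G φ W β n i j * etaN G φ W n j else 1

/-- The limits `Ĝ = lim Ĝ^{(n)}` and `ψ = lim ψ^{(n)}` exist in `ℝ`. -/
def LimitsExist : Prop :=
  (∀ i j, ∃ l : ℝ, Tendsto (fun n => greenN G φ W β n i j) atTop (𝓝 l)) ∧
    ∀ i, ∃ l : ℝ, Tendsto (fun n => psiN G φ W β n i) atTop (𝓝 l)

/-- `Ĝ(i,j) = lim Ĝ^{(n)}(i,j)`. -/
def green (i j : V) : ℝ := limUnder atTop fun n => greenN G φ W β n i j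

/-- `ψ(i) = lim ψ^{(n)}(i)`. -/
def psi (i : V) : ℝ := limUnder atTop fun n => psiN G φ W β n i

/-- The conductances `c^ψ_{i,j} = W_{i,j} ψ(i) ψ(j)`. -/
def cPsi (i j : V) : ℝ := W i j * psi G φ W β i * psi G φ W β j

variable [MeasurableSpace V] [DiscreteMeasurableSpace V]

/-- The harmonic measure `μ_i^ψ` of the random walk in the conductances `c^ψ`; it is the null measure
unless `ψ > 0` and this walk is transient. -/
def harmonicMeasure (i : V) : Measure (Ends G φ) :=
  open scoped Classical in
  if (∀ k, 0 < psi G φ W β k) ∧ IsTransient (cPsi G φ W β) then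
    exitMeasure G φ (cPsi G φ W β) i
  else 0

/-- The measure `χ(i,·) = ψ(i) μ_i^ψ` on `Ω`. -/
def chi (i : V) : Measure (Ends G φ) :=
  ENNReal.ofReal (psi G φ W β i) • harmonicMeasure G φ W β i

/-- The matrix `Č_m` on `B_m`. -/
def checkC (m : ℕ) (x x' : generation G φ m) : ℝ :=
  if x = x' then 0
  else (chi G φ W β (meet G φ x x')).real (endsThrough (x : V)) *
      (chi G φ W β (meet G φ x x')).real (endsThrough (x' : V)) /
    green G φ W β (meet G φ x x') (meet G φ x x')

/-- The set `𝒟_{B_m}^{Č_m}` of the `ρ` such that `2ρ - Č_m` is positive definite. -/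
def boundaryPotentials (m : ℕ) : Set (generation G φ m → ℝ) :=
  {ρ | (schrodinger (checkC G φ W β m) ρ).PosDef}

variable {m : ℕ} (ρ : generation G φ m → ℝ)

/-- `Ǧ_m = (2ρ_m - Č_m)⁻¹`. -/
def checkGreen : Matrix (generation G φ m) (generation G φ m) ℝ :=
  (schrodinger (checkC G φ W β m) ρ)⁻¹

/-- The function `ǧ_m` on `Ω × Ω`, equal to `Ǧ_m(δ_x,δ_x')` on `Ω_x × Ω_x'` for `x, x'` in the
generation `m`. (A ray `ω` crosses the generation `m` exactly at `ω_m`, so the last case does not occur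
on a tree.) -/
def checkg (ω τ : Ends G φ) : ℝ :=
  if h : ω.1 m ∈ generation G φ m ∧ τ.1 m ∈ generation G φ m then
    checkGreen G φ W β ρ ⟨ω.1 m, h.1⟩ ⟨τ.1 m, h.2⟩
  else 0

/-- `G_m(i,j) = Ĝ(i,j) + ∫_{Ω²} χ(i,dω) χ(j,dτ) ǧ_m(ω,τ)`. -/
def greenM (i j : V) : ℝ :=
  green G φ W β i j +
    ∫ p, checkg G φ W β ρ p.1 p.2 ∂((chi G φ W β i).prod (chi G φ W β j))

/-- The jump rates `½ W_{i,j} G_m(i₀,j) / G_m(i₀,i)` of the process `P^{β,ρ_m,i₀}`. -/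
def rate (i₀ i j : V) : ℝ :=
  1 / 2 * W i j * (greenM G φ W β ρ i₀ j / greenM G φ W β ρ i₀ i)

end Environment

end VRJPTree

end

namespace VRJPTree

section TreeGeometry

variable {V : Type*} {G : SimpleGraph V} {φ : V}

theorem parent_unique (hG : G.IsTree) {y z z' : V} (hz : G.Adj z y) (hz' : G.Adj z' y)
    (h : G.dist φ y = G.dist φ z + 1) (h' : G.dist φ y = G.dist φ z' + 1) : z = z' := by
  obtain ⟨p, hp⟩ := hG.connected.exists_walk_length_eq_dist φ z
  obtain ⟨p', hp'⟩ := hG.connected.exists_walk_length_eq_dist φ z'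
  have h1 : (p.concat hz).IsPath :=
    SimpleGraph.Walk.isPath_of_length_eq_dist _ (by simp [hp, h])
  have h2 : (p'.concat hz').IsPath :=
    SimpleGraph.Walk.isPath_of_length_eq_dist _ (by simp [hp', h'])
  have := (hG.existsUnique_path φ y).unique h1 h2
  simpa using congrArg SimpleGraph.Walk.penultimate this

theorem isAncestor_refl (x : V) : IsAncestor G φ x x := by simp [IsAncestor]

theorem isAncestor_root (x : V) : IsAncestor G φ φ x := by simp [IsAncestor]

theorem IsAncestor.dist_le {x y : V} (h : IsAncestor G φ x y) : G.dist φ x ≤ G.dist φ y := by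
  unfold IsAncestor at h; omega

theorem IsAncestor.eq_of_dist_le (hG : G.IsTree) {x y : V} (h : IsAncestor G φ x y)
    (hd : G.dist φ y ≤ G.dist φ x) : x = y := by
  unfold IsAncestor at h
  exact hG.connected.dist_eq_zero_iff.1 (by omega)

theorem isAncestor_child_iff (hG : G.IsTree) {x y y' : V} (h : G.Adj y y')
    (hd : G.dist φ y' = G.dist φ y + 1) :
    IsAncestor G φ x y' ↔ x = y' ∨ IsAncestor G φ x y := by
  constructor
  · intro hx
    by_cases hxy : x = y'
    · exact Or.inl hxy
    right
    obtain ⟨p, hp⟩ := hG.connected.exists_walk_length_eq_dist y' x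
    cases p with
    | nil => exact absurd rfl hxy
    | @cons _ z _ hz q =>
      have h1 := SimpleGraph.dist_le q
      rw [SimpleGraph.Walk.length_cons, SimpleGraph.dist_comm] at hp
      rw [SimpleGraph.dist_comm] at h1
      unfold IsAncestor at hx ⊢
      have h2 := hG.connected.dist_triangle (u := φ) (v := x) (w := z)
      have h3 := hG.dist_eq_dist_add_one_of_adj φ hz
      have hzy : z = y := parent_unique hG (φ := φ) hz.symm h (by omega) hd
      subst hzy
      omega
  · rintro (rfl | hx)
    · exact isAncestor_refl _
    · unfold IsAncestor at hx ⊢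
      have h1 := hG.connected.dist_triangle (u := φ) (v := x) (w := y')
      have h2 := hG.connected.dist_triangle (u := x) (v := y) (w := y')
      have h3 := SimpleGraph.dist_eq_one_iff_adj.2 h
      omega

theorem exists_parent (hG : G.IsTree) {y : V} (hy : y ≠ φ) :
    ∃ z, G.Adj z y ∧ G.dist φ y = G.dist φ z + 1 := by
  obtain ⟨p, hp⟩ := hG.connected.exists_walk_length_eq_dist y φ
  cases p with
  | nil => exact absurd rfl hy
  | @cons _ z _ hz q =>
    have h1 := SimpleGraph.dist_le q
    rw [SimpleGraph.Walk.length_cons, SimpleGraph.dist_comm] at hp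
    rw [SimpleGraph.dist_comm] at h1
    have h3 := hG.dist_eq_dist_add_one_of_adj φ hz
    exact ⟨z, hz.symm, by omega⟩

theorem IsAncestor.unique (hG : G.IsTree) {x x' y : V} (h : IsAncestor G φ x y)
    (h' : IsAncestor G φ x' y) (hd : G.dist φ x = G.dist φ x') : x = x' := by
  induction hn : G.dist φ y generalizing y with
  | zero =>
    rw [h.eq_of_dist_le hG (by omega), h'.eq_of_dist_le hG (by omega)]
  | succ n ih =>
    have hy : y ≠ φ := by rintro rfl; simp at hn
    obtain ⟨z, hz, hzd⟩ := exists_parent (φ := φ) hG hy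
    rcases (isAncestor_child_iff hG hz hzd).1 h with rfl | h1
    · exact (h'.eq_of_dist_le hG (by omega)).symm
    rcases (isAncestor_child_iff hG hz hzd).1 h' with rfl | h2
    · exact h.eq_of_dist_le hG (by omega)
    exact ih h1 h2 (by omega)

theorem exists_ancestor (hG : G.IsTree) {k : ℕ} {y : V} (hk : k ≤ G.dist φ y) :
    ∃ x, IsAncestor G φ x y ∧ G.dist φ x = k := by
  induction hn : G.dist φ y generalizing y with
  | zero => exact ⟨y, isAncestor_refl y, by omega⟩
  | succ n ih =>
    rcases hk.eq_or_lt with rfl | hlt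
    · exact ⟨y, isAncestor_refl y, rfl⟩
    have hy : y ≠ φ := by rintro rfl; simp at hn
    obtain ⟨z, hz, hzd⟩ := exists_parent (φ := φ) hG hy
    obtain ⟨x, hx, hxk⟩ := ih (y := z) (by omega) (by omega)
    exact ⟨x, (isAncestor_child_iff hG hz hzd).2 (Or.inr hx), hxk⟩

theorem adj_of_isAncestor (hG : G.IsTree) {x x' y : V} (h : IsAncestor G φ x y)
    (h' : IsAncestor G φ x' y) (hd : G.dist φ x' = G.dist φ x + 1) : G.Adj x x' := by
  induction hn : G.dist φ y generalizing y with
  | zero => have := h'.dist_le; omega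
  | succ n ih =>
    have hy : y ≠ φ := by rintro rfl; simp at hn
    obtain ⟨z, hz, hzd⟩ := exists_parent (φ := φ) hG hy
    rcases (isAncestor_child_iff hG hz hzd).1 h with rfl | h1
    · have := h'.dist_le; omega
    rcases (isAncestor_child_iff hG hz hzd).1 h' with rfl | h2
    · rwa [h1.unique hG (isAncestor_refl z) (by omega)]
    exact ih h1 h2 (by omega)

theorem isAncestor_adj_iff (hG : G.IsTree) {x y y' : V} (h : G.Adj y y') (hxy : x ≠ y)
    (hxy' : x ≠ y') : IsAncestor G φ x y ↔ IsAncestor G φ x y' := by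
  rcases hG.dist_eq_dist_add_one_of_adj φ h with hd | hd
  · simp [isAncestor_child_iff hG h.symm hd, hxy]
  · simp [isAncestor_child_iff hG h hd, hxy']

/-- A branch is entered through its root only. -/
theorem eq_of_adj_of_isAncestor (hG : G.IsTree) {x y y' : V} (h : G.Adj y y')
    (hy : ¬ IsAncestor G φ x y) (hy' : IsAncestor G φ x y') : y' = x := by
  by_contra hne
  exact hy ((isAncestor_adj_iff hG h (by rintro rfl; exact hy (isAncestor_refl _))
    (Ne.symm hne)).2 hy')

theorem ray_dist (hG : G.IsTree) (ω : Ends G φ) (k : ℕ) : G.dist φ (ω.1 k) = k := by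
  obtain ⟨ω, h0, hadj, hinj⟩ := ω
  induction k using Nat.strong_induction_on with
  | _ k ih =>
    match k with
    | 0 => simp [h0]
    | 1 =>
      have := hadj 0
      rw [h0] at this
      simpa using SimpleGraph.dist_eq_one_iff_adj.2 this
    | k + 2 =>
      have h1 := ih k (by omega)
      have h2 := ih (k + 1) (by omega)
      simp only at h1 h2 ⊢
      rcases hG.dist_eq_dist_add_one_of_adj φ (hadj (k + 1)) with h | h
      · have := parent_unique hG (hadj (k + 1)).symm (hadj k) h (by omega)
        have := hinj this
        omega
      · exact h.trans (by omega)

theorem ray_apply_eq_iff (hG : G.IsTree) (ω : Ends G φ) {x : V} {k : ℕ} (hx : G.dist φ x = k) :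
    ω.1 k = x ↔ ω ∈ endsThrough x := by
  refine ⟨fun h => ⟨k, h⟩, ?_⟩
  rintro ⟨l, rfl⟩
  rw [ray_dist hG] at hx
  rw [hx]

theorem ConvergesToEnd.eventually_isAncestor_iff (hG : G.IsTree) {X : ℕ → V} {ω : Ends G φ}
    (h : ConvergesToEnd X ω) (x : V) :
    ∀ᶠ n in atTop, (IsAncestor G φ x (X n) ↔ ω ∈ endsThrough x) := by
  filter_upwards [h (G.dist φ x)] with n hn
  constructor
  · intro hx
    exact ⟨_, hn.unique hG hx (ray_dist hG ω _)⟩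
  · rintro ⟨k, rfl⟩
    rwa [ray_dist hG] at hn

theorem convergesToEnd_of_adj (hG : G.IsTree) [G.LocallyFinite] {X : ℕ → V}
    (hX : ∀ n, G.Adj (X n) (X (n + 1))) (hleave : ∀ x, ∀ᶠ n in atTop, X n ≠ x) :
    ∃ ω : Ends G φ, ConvergesToEnd X ω := by
  classical
  have hdeep : ∀ k, ∀ᶠ n in atTop, k ≤ G.dist φ (X n) := by
    intro k
    have : ∀ᶠ n in atTop, ∀ x ∈ ball G φ k, X n ≠ x :=
      (Filter.eventually_all_finset _).2 fun x _ => hleave x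
    filter_upwards [this] with n hn
    by_contra hlt
    exact hn _ ((mem_ball_iff G φ hG.connected k _).2 (by omega)) rfl
  have hanc : ∀ k, ∃ x, G.dist φ x = k ∧ ∀ᶠ n in atTop, IsAncestor G φ x (X n) := by
    intro k
    obtain ⟨N, hN⟩ := eventually_atTop.1 (hdeep (k + 1))
    obtain ⟨x, hx, hxk⟩ := exists_ancestor (φ := φ) hG (k := k) (y := X N)
      (by have := hN N le_rfl; omega)
    refine ⟨x, hxk, eventually_atTop.2 ⟨N, fun n hn => ?_⟩⟩
    induction n, hn using Nat.le_induction with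
    | base => exact hx
    | succ n hn ih =>
      have h1 := hN n hn
      have h2 := hN (n + 1) (by omega)
      exact (isAncestor_adj_iff hG (hX n) (by rintro rfl; omega) (by rintro rfl; omega)).1 ih
  choose ω hω hconv using hanc
  refine ⟨⟨ω, ?_, ?_, ?_⟩, hconv⟩
  · exact (hG.connected.dist_eq_zero_iff.1 (hω 0)).symm
  · intro k
    obtain ⟨n, h1, h2⟩ := ((hconv k).and (hconv (k + 1))).exists
    exact adj_of_isAncestor hG h1 h2 (by rw [hω, hω])
  · intro k l hkl
    rw [← hω k, ← hω l, hkl]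

theorem countable_of_locallyFinite (hG : G.Connected) [G.LocallyFinite] (φ : V) : Countable V := by
  classical
  rw [← Set.countable_univ_iff]
  have : (Set.univ : Set V) = ⋃ n, (ball G φ n : Set V) := by
    ext x
    simpa using ⟨_, (mem_ball_iff G φ hG _ x).2 le_rfl⟩
  rw [this]
  exact Set.countable_iUnion fun n => (ball G φ n).countable_toSet

theorem exists_adj [Infinite V] (hG : G.IsTree) (x : V) : ∃ y, G.Adj x y := by
  obtain ⟨z, hz⟩ := exists_ne x
  obtain ⟨y, hy, -⟩ := exists_parent (φ := z) hG hz.symm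
  exact ⟨y, hy.symm⟩

end TreeGeometry

end VRJPTree

namespace VRJPTree

open scoped ENNReal

section Trace

variable {V : Type*} {G : SimpleGraph V} [MeasurableSpace V]

variable (G) in
/-- The set `S` of ends is read off from the set `A` of vertices visited in the long run. -/
structure IsTraceOf (φ : V) (A : Set V) (S : Set (Ends G φ)) : Prop where
  measurableSet : MeasurableSet S
  eventually_iff : ∀ (X : ℕ → V) (ω : Ends G φ), ConvergesToEnd X ω →
    ∀ᶠ n in atTop, (X n ∈ A ↔ ω ∈ S)

theorem isTraceOf_univ {φ : V} : IsTraceOf G φ Set.univ Set.univ :=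
  ⟨MeasurableSet.univ, fun _ _ _ => by simp⟩

theorem IsTraceOf.compl {φ : V} {A : Set V} {S : Set (Ends G φ)} (h : IsTraceOf G φ A S) :
    IsTraceOf G φ Aᶜ Sᶜ :=
  ⟨h.measurableSet.compl, fun X ω hX => (h.eventually_iff X ω hX).mono fun _ hn => not_congr hn⟩

theorem IsTraceOf.inter {φ : V} {A A' : Set V} {S S' : Set (Ends G φ)} (h : IsTraceOf G φ A S)
    (h' : IsTraceOf G φ A' S') : IsTraceOf G φ (A ∩ A') (S ∩ S') :=
  ⟨h.measurableSet.inter h'.measurableSet, fun X ω hX =>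
    ((h.eventually_iff X ω hX).and (h'.eventually_iff X ω hX)).mono
      fun _ hn => and_congr hn.1 hn.2⟩

theorem measurable_ray_apply (φ : V) (k : ℕ) : Measurable fun ω : Ends G φ => ω.1 k :=
  (measurable_pi_apply k).comp measurable_subtype_coe

theorem measurableSet_endsThrough [DiscreteMeasurableSpace V] (φ x : V) :
    MeasurableSet (endsThrough x : Set (Ends G φ)) := by
  have : (endsThrough x : Set (Ends G φ)) = ⋃ k, (fun ω : Ends G φ => ω.1 k) ⁻¹' {x} := by
    ext ω
    simp [endsThrough]
  rw [this]
  exact MeasurableSet.iUnion fun k => measurable_ray_apply φ k (measurableSet_singleton x)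

theorem isTraceOf_endsThrough [DiscreteMeasurableSpace V] (hT : G.IsTree) (φ x : V) :
    IsTraceOf G φ {y | IsAncestor G φ x y} (endsThrough x) :=
  ⟨measurableSet_endsThrough φ x, fun _ _ hX => hX.eventually_isAncestor_iff hT x⟩

theorem measurable_limitEnd [DiscreteMeasurableSpace V] [Countable V]
    (hT : G.IsTree) (φ : V) :
    Measurable fun X : {X : ℕ → V // ∃ ω : Ends G φ, ConvergesToEnd X ω} => X.2.choose := by
  refine measurable_comap_iff.2 (measurable_pi_iff.2 fun k => ?_)
  refine measurable_to_countable' fun x => ?_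
  simp only [Function.comp_def]
  by_cases hx : G.dist φ x = k
  · have : (fun X : {X : ℕ → V // ∃ ω : Ends G φ, ConvergesToEnd X ω} => X.2.choose.1 k) ⁻¹' {x} =
        Subtype.val ⁻¹' {X : ℕ → V | ∀ᶠ n in atTop, X n ∈ {y | IsAncestor G φ x y}} := by
      ext X
      have h := X.2.choose_spec.eventually_isAncestor_iff hT x
      simp only [Set.mem_preimage, Set.mem_singleton_iff, Set.mem_ofPred_eq,
        ray_apply_eq_iff hT _ hx]
      constructor
      · intro hX
        filter_upwards [h] with n hn using hn.2 hX
      · intro hX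
        obtain ⟨n, h1, h2⟩ := (h.and hX).exists
        exact h1.1 h2
    rw [this]
    refine measurable_subtype_coe ?_
    simp only [eventually_atTop, Set.ofPred_exists, Set.ofPred_forall]
    exact MeasurableSet.iUnion fun N => MeasurableSet.iInter fun n => MeasurableSet.iInter fun _ =>
      measurable_pi_apply n (MeasurableSet.of_discrete (s := {y | IsAncestor G φ x y}))
  · convert MeasurableSet.empty
    ext X
    simp only [Set.mem_preimage, Set.mem_singleton_iff, Set.mem_empty_iff_false, iff_false]
    rintro rfl
    exact hx (ray_dist hT _ k)

end Trace

section Walk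

variable {V : Type*} {G : SimpleGraph V} [G.LocallyFinite] {W : V → V → ℝ} {f : V → ℝ}
  {r : V → V → ℝ}

/-- `∑_{j ∼ i} W_{i,j} f(j)`, the off-diagonal part of the Schrödinger operator. -/
noncomputable def adjSum (G : SimpleGraph V) [G.LocallyFinite] (W : V → V → ℝ) (f : V → ℝ)
    (i : V) : ℝ :=
  ∑ j ∈ G.neighborFinset i, W i j * f j

/-- The transition operator of the random walk which jumps from `i` to `j` with probability
proportional to `W_{i,j} f(j)`. -/
noncomputable def walkOp (G : SimpleGraph V) [G.LocallyFinite] (W : V → V → ℝ) (f : V → ℝ) :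
    (V → ℝ) →ₗ[ℝ] (V → ℝ) where
  toFun g i := adjSum G W (fun j => f j * g j) i / adjSum G W f i
  map_add' g g' := by
    ext i
    simp [adjSum, mul_add, Finset.sum_add_distrib, add_div]
  map_smul' a g := by
    ext i
    simp only [adjSum, Pi.smul_apply, smul_eq_mul, RingHom.id_apply, ← mul_div_assoc,
      Finset.mul_sum]
    congr 1
    exact Finset.sum_congr rfl fun j _ => by ring

theorem walkOp_apply (g : V → ℝ) (i : V) :
    walkOp G W f g i = adjSum G W (fun j => f j * g j) i / adjSum G W f i := rfl

theorem adjSum_mono (hW : IsConductance G W) {g g' : V → ℝ} {i : V}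
    (h : ∀ j, G.Adj i j → g j ≤ g' j) : adjSum G W g i ≤ adjSum G W g' i :=
  Finset.sum_le_sum fun j hj => by
    rw [SimpleGraph.mem_neighborFinset] at hj
    exact mul_le_mul_of_nonneg_left (h j hj) (hW.pos i j hj).le

theorem adjSum_pos (hW : IsConductance G W) (hG : ∀ x, ∃ y, G.Adj x y) (hf : ∀ i, 0 < f i)
    (i : V) : 0 < adjSum G W f i := by
  obtain ⟨j, hj⟩ := hG i
  refine Finset.sum_pos (fun j hj => ?_) ⟨j, by simpa using hj⟩
  rw [SimpleGraph.mem_neighborFinset] at hj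
  exact mul_pos (hW.pos i j hj) (hf j)

theorem walkOp_one (hW : IsConductance G W) (hG : ∀ x, ∃ y, G.Adj x y) (hf : ∀ i, 0 < f i) :
    walkOp G W f 1 = 1 := by
  ext i
  simp only [walkOp_apply, Pi.one_apply, mul_one]
  exact div_self (adjSum_pos hW hG hf i).ne'

theorem walkOp_mono (hW : IsConductance G W) (hG : ∀ x, ∃ y, G.Adj x y) (hf : ∀ i, 0 < f i)
    {g g' : V → ℝ} {i : V} (h : ∀ j, G.Adj i j → g j ≤ g' j) :
    walkOp G W f g i ≤ walkOp G W f g' i := by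
  rw [walkOp_apply, walkOp_apply]
  exact div_le_div_of_nonneg_right
    (adjSum_mono hW fun j hj => mul_le_mul_of_nonneg_left (h j hj) (hf j).le)
    (adjSum_pos hW hG hf i).le

theorem walkOp_pow_mono (hW : IsConductance G W) (hG : ∀ x, ∃ y, G.Adj x y) (hf : ∀ i, 0 < f i)
    {g g' : V → ℝ} (h : g ≤ g') (n : ℕ) : (walkOp G W f ^ n) g ≤ (walkOp G W f ^ n) g' := by
  induction n with
  | zero => simpa using h
  | succ n ih =>
    simp only [pow_succ', Module.End.mul_apply]
    exact fun i => walkOp_mono hW hG hf fun j _ => ih j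

theorem walkOp_pow_nonneg (hW : IsConductance G W) (hG : ∀ x, ∃ y, G.Adj x y)
    (hf : ∀ i, 0 < f i) {g : V → ℝ} (h : 0 ≤ g) (n : ℕ) : 0 ≤ (walkOp G W f ^ n) g := by
  simpa using walkOp_pow_mono hW hG hf h n

theorem walkOp_pow_one (hW : IsConductance G W) (hG : ∀ x, ∃ y, G.Adj x y)
    (hf : ∀ i, 0 < f i) (n : ℕ) : (walkOp G W f ^ n) 1 = 1 := by
  induction n with
  | zero => simp
  | succ n ih => simp [pow_succ', ih, walkOp_one hW hG hf]

/-- The jump rates `r` are proportional, at each site `i`, to `W_{i,j} f(j)`. -/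
def IsWalkRate (W : V → V → ℝ) (f : V → ℝ) (r : V → V → ℝ) : Prop :=
  ∃ c : V → ℝ, (∀ i, 0 < c i) ∧ ∀ i j, r i j = c i * W i j * f j

theorem jumpPMF_apply (hW : IsConductance G W) (hG : ∀ x, ∃ y, G.Adj x y) (hf : ∀ i, 0 < f i)
    (hr : IsWalkRate W f r) (i j : V) :
    jumpPMF r i j = ENNReal.ofReal (W i j * f j / adjSum G W f i) := by
  obtain ⟨c, hc, hr⟩ := hr
  have hW0 : ∀ i j, 0 ≤ W i j := fun i j => by
    by_cases h : G.Adj i j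
    · exact (hW.pos i j h).le
    · exact (hW.zero i j h).ge
  have hN := adjSum_pos hW hG hf i
  have hsum : ∑' j, ENNReal.ofReal (r i j) = ENNReal.ofReal (c i * adjSum G W f i) := by
    rw [tsum_eq_sum (s := G.neighborFinset i), adjSum, Finset.mul_sum, ENNReal.ofReal_sum_of_nonneg]
    · exact Finset.sum_congr rfl fun j _ => by rw [hr, mul_assoc]
    · exact fun j _ => mul_nonneg (hc i).le (mul_nonneg (hW0 i j) (hf j).le)
    · intro j hj
      rw [SimpleGraph.mem_neighborFinset] at hj
      simp [hr, hW.zero i j hj]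
  have hpos := mul_pos (hc i) hN
  have h : (∑' j, ENNReal.ofReal (r i j)) ≠ 0 ∧ (∑' j, ENNReal.ofReal (r i j)) ≠ ⊤ := by
    rw [hsum]
    simpa using hpos
  rw [jumpPMF, dif_pos h, PMF.normalize_apply, hsum, hr, ← ENNReal.ofReal_inv_of_pos hpos,
    ← ENNReal.ofReal_mul (mul_nonneg (mul_nonneg (hc i).le (hW0 i j)) (hf j).le)]
  congr 1
  have := (hc i).ne'
  field_simp

variable [MeasurableSpace V] [DiscreteMeasurableSpace V]

instance (r : V → V → ℝ) (x : V) : IsProbabilityMeasure (chainLaw r x) := by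
  unfold chainLaw; infer_instance

theorem chainLaw_zero (r : V → V → ℝ) (x : V) (g : V → ℝ≥0∞) :
    ∫⁻ X, g (X 0) ∂chainLaw r x = g x := by
  unfold chainLaw
  have hg : Measurable g := Measurable.of_discrete
  rw [Kernel.lintegral_traj (f := fun X : ℕ → V => g (X 0)) _ (hg.comp (measurable_pi_apply 0))]
  simp [Function.updateFinset]

variable [Countable V]

theorem lintegral_jumpKernel (hW : IsConductance G W) (hG : ∀ x, ∃ y, G.Adj x y)
    (hf : ∀ i, 0 < f i) (hr : IsWalkRate W f r) {g : V → ℝ} (hg : 0 ≤ g) (i : V) :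
    ∫⁻ j, ENNReal.ofReal (g j) ∂jumpKernel r i = ENNReal.ofReal (walkOp G W f g i) := by
  have hN := adjSum_pos hW hG hf i
  rw [lintegral_countable', tsum_eq_sum (s := G.neighborFinset i), walkOp_apply, adjSum,
    Finset.sum_div, ENNReal.ofReal_sum_of_nonneg]
  · refine Finset.sum_congr rfl fun j _ => ?_
    change _ * (jumpPMF r i).toMeasure {j} = _
    rw [PMF.toMeasure_apply_singleton _ _ (measurableSet_singleton j), jumpPMF_apply hW hG hf hr,
      ← ENNReal.ofReal_mul (hg j)]
    congr 1
    ring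
  · intro j hj
    rw [SimpleGraph.mem_neighborFinset] at hj
    exact div_nonneg (mul_nonneg (hW.pos i j hj).le (mul_nonneg (hf j).le (hg j))) hN.le
  · intro j hj
    rw [SimpleGraph.mem_neighborFinset] at hj
    change _ * (jumpPMF r i).toMeasure {j} = _
    rw [PMF.toMeasure_apply_singleton _ _ (measurableSet_singleton j), jumpPMF_apply hW hG hf hr,
      hW.zero i j hj]
    simp

/-- The Markov property of the chain of visited sites, for one step. -/
theorem lintegral_chainLaw_succ (r : V → V → ℝ) (x : V) (n : ℕ) (F : V → V → ℝ≥0∞) :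
    ∫⁻ X, F (X n) (X (n + 1)) ∂chainLaw r x =
      ∫⁻ X, ∫⁻ j, F (X n) j ∂jumpKernel r (X n) ∂chainLaw r x := by
  unfold chainLaw
  set κ : (n : ℕ) → Kernel ((i : Finset.Iic n) → V) V := fun n =>
    (jumpKernel r).comap (fun h : (i : Finset.Iic n) → V => h ⟨n, by simp⟩)
      (measurable_pi_apply _) with hκ
  have key := Kernel.partialTraj_compProd_eq_map_traj (X := fun _ : ℕ => V) (κ := κ)
    (Nat.zero_le n) (x₀ := fun _ => x)
  have hF : Measurable fun p : V × V => F p.1 p.2 := Measurable.of_discrete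
  have hF' : Measurable fun p : ((i : Finset.Iic n) → V) × V => F (p.1 ⟨n, by simp⟩) p.2 :=
    hF.comp (f := fun p : ((i : Finset.Iic n) → V) × V => (p.1 ⟨n, by simp⟩, p.2))
      (((measurable_pi_apply _).comp measurable_fst).prodMk measurable_snd)
  have hG' : Measurable fun i => ∫⁻ j, F i j ∂jumpKernel r i := Measurable.of_discrete
  have h1 : ∫⁻ X, F (X n) (X (n + 1)) ∂Kernel.traj (X := fun _ => V) κ 0 (fun _ => x) =
      ∫⁻ p : ((i : Finset.Iic n) → V) × V, F (p.1 ⟨n, by simp⟩) p.2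
        ∂((Kernel.traj (X := fun _ => V) κ 0 (fun _ => x)).map
          (fun X : ℕ → V => (Preorder.frestrictLe (π := fun _ => V) n X, X (n + 1)))) := by
    rw [lintegral_map hF' (by fun_prop)]
    rfl
  have h2 : ∫⁻ X, ∫⁻ j, F (X n) j ∂jumpKernel r (X n)
        ∂Kernel.traj (X := fun _ => V) κ 0 (fun _ => x) =
      ∫⁻ h, ∫⁻ j, F (h ⟨n, by simp⟩) j ∂jumpKernel r (h ⟨n, by simp⟩)
        ∂(Kernel.partialTraj (X := fun _ => V) κ 0 n (fun _ => x)) := by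
    have hm : Measurable fun h : (i : Finset.Iic n) → V =>
        ∫⁻ j, F (h ⟨n, by simp⟩) j ∂jumpKernel r (h ⟨n, by simp⟩) :=
      hG'.comp (f := fun h : (i : Finset.Iic n) → V => h ⟨n, by simp⟩) (measurable_pi_apply _)
    rw [← Kernel.traj_map_frestrictLe_apply, lintegral_map hm (by fun_prop)]
    rfl
  rw [h1, h2, ← key, Measure.lintegral_compProd hF']
  rfl

theorem lintegral_chainLaw (hW : IsConductance G W) (hG : ∀ x, ∃ y, G.Adj x y)
    (hf : ∀ i, 0 < f i) (hr : IsWalkRate W f r) (x : V) (n : ℕ) {g : V → ℝ} (hg : 0 ≤ g) :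
    ∫⁻ X, ENNReal.ofReal (g (X n)) ∂chainLaw r x =
      ENNReal.ofReal ((walkOp G W f ^ n) g x) := by
  induction n generalizing g with
  | zero => simpa using chainLaw_zero r x fun j => ENNReal.ofReal (g j)
  | succ n ih =>
    rw [lintegral_chainLaw_succ r x n fun _ j => ENNReal.ofReal (g j)]
    simp only [lintegral_jumpKernel hW hG hf hr hg]
    rw [ih (by simpa using walkOp_pow_nonneg hW hG hf hg 1), pow_succ, Module.End.mul_apply]

theorem chainLaw_apply (hW : IsConductance G W) (hG : ∀ x, ∃ y, G.Adj x y)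
    (hf : ∀ i, 0 < f i) (hr : IsWalkRate W f r) (x : V) (n : ℕ) (A : Set V) :
    chainLaw r x {X | X n ∈ A} =
      ENNReal.ofReal ((walkOp G W f ^ n) (A.indicator 1) x) := by
  have hA : MeasurableSet {X : ℕ → V | X n ∈ A} :=
    measurable_pi_apply n (MeasurableSet.of_discrete (s := A))
  rw [← lintegral_chainLaw hW hG hf hr x n (g := A.indicator 1)
    (Set.indicator_nonneg fun _ _ => zero_le_one), ← lintegral_indicator_one hA]
  refine lintegral_congr fun X => ?_
  by_cases h : X n ∈ A <;> simp [h]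

theorem chainLaw_ae_adj (hW : IsConductance G W) (hG : ∀ x, ∃ y, G.Adj x y)
    (hf : ∀ i, 0 < f i) (hr : IsWalkRate W f r) (x : V) :
    ∀ᵐ X ∂chainLaw r x, ∀ n, G.Adj (X n) (X (n + 1)) := by
  classical
  refine ae_all_iff.2 fun n => ?_
  have h := lintegral_chainLaw_succ r x n fun i j => if G.Adj i j then 0 else 1
  have h0 : ∀ i, ∫⁻ j, (if G.Adj i j then 0 else 1) ∂jumpKernel r i = 0 := by
    intro i
    have := lintegral_jumpKernel hW hG hf hr (g := fun j => if G.Adj i j then 0 else 1)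
      (fun j => by dsimp; split_ifs <;> norm_num) i
    convert this using 1
    · exact lintegral_congr fun j => by split_ifs <;> simp
    · rw [walkOp_apply, adjSum, Finset.sum_eq_zero]
      · simp
      · intro j hj
        rw [SimpleGraph.mem_neighborFinset] at hj
        simp [hj]
  simp only [h0, lintegral_zero] at h
  have hm : Measurable fun X : ℕ → V => (if G.Adj (X n) (X (n + 1)) then 0 else 1 : ℝ≥0∞) :=
    (Measurable.of_discrete (f := fun p : V × V => (if G.Adj p.1 p.2 then 0 else 1 : ℝ≥0∞))).comp
      (f := fun X : ℕ → V => (X n, X (n + 1))) (by fun_prop)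
  rw [lintegral_eq_zero_iff hm] at h
  filter_upwards [h] with X hX
  by_contra hne
  simp [hne] at hX

theorem chainLaw_ae_leaves (ht : IsTransient r) (x : V) :
    ∀ᵐ X ∂chainLaw r x, ∀ y, ∀ᶠ n in atTop, X n ≠ y := by
  refine ae_all_iff.2 fun y => ?_
  exact ae_eventually_notMem (ht x y)

theorem chainLaw_ae_convergesToEnd (hT : G.IsTree) (hW : IsConductance G W)
    (hG : ∀ x, ∃ y, G.Adj x y) (hf : ∀ i, 0 < f i) (hr : IsWalkRate W f r)
    (ht : IsTransient r) (φ x : V) :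
    ∀ᵐ X ∂chainLaw r x, ∃ ω : Ends G φ, ConvergesToEnd X ω := by
  filter_upwards [chainLaw_ae_adj hW hG hf hr x, chainLaw_ae_leaves ht x] with X h1 h2
  exact convergesToEnd_of_adj hT h1 h2

theorem summable_walkOp_pow (hW : IsConductance G W) (hG : ∀ x, ∃ y, G.Adj x y)
    (hf : ∀ i, 0 < f i) (hr : IsWalkRate W f r) (ht : IsTransient r) (x y : V) :
    Summable fun n => (walkOp G W f ^ n) (Set.indicator {y} 1) x := by
  have h := ht x y
  have h1 : ∀ k, chainLaw r x {X | X k = y} =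
      ENNReal.ofReal ((walkOp G W f ^ k) (Set.indicator {y} 1) x) :=
    fun k => chainLaw_apply hW hG hf hr x k {y}
  simp only [h1] at h
  have h2 := ENNReal.summable_toReal h
  refine h2.congr fun n => ENNReal.toReal_ofReal ?_
  exact walkOp_pow_nonneg hW hG hf (Set.indicator_nonneg fun _ _ => zero_le_one) n x

theorem tendsto_exitMeasure (hT : G.IsTree) (hW : IsConductance G W)
    (hG : ∀ x, ∃ y, G.Adj x y) (hf : ∀ i, 0 < f i) (hr : IsWalkRate W f r)
    (ht : IsTransient r) {φ : V} {A : Set V} {S : Set (Ends G φ)} (hAS : IsTraceOf G φ A S)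
    (x : V) :
    Tendsto (fun n => (walkOp G W f ^ n) (A.indicator 1) x) atTop
      (𝓝 ((exitMeasure G φ r x).real S)) := by
  have hconv := chainLaw_ae_convergesToEnd hT hW hG hf hr ht φ x
  set C := {X : ℕ → V | ∃ ω : Ends G φ, ConvergesToEnd X ω} with hC
  set E := {X : ℕ → V | ∀ᶠ n in atTop, X n ∈ A} with hE
  have hEm : MeasurableSet E := by
    simp only [hE, eventually_atTop, Set.ofPred_exists, Set.ofPred_forall]
    exact MeasurableSet.iUnion fun N => MeasurableSet.iInter fun n => MeasurableSet.iInter fun _ =>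
      measurable_pi_apply n (MeasurableSet.of_discrete (s := A))
  have hCnull : NullMeasurableSet C (chainLaw r x) :=
    nullMeasurableSet_univ.congr (eventuallyEq_univ.2 hconv).symm
  have himage : ∀ s : Set C, MeasurableSet s →
      NullMeasurableSet (Subtype.val '' s) (chainLaw r x) := by
    rintro s ⟨t, ht, rfl⟩
    rw [Subtype.image_preimage_coe]
    exact hCnull.inter ht.nullMeasurableSet
  have hexit : exitMeasure G φ r x S = chainLaw r x E := by
    have hm := measurable_limitEnd hT φ
    rw [exitMeasure, Measure.map_apply hm hAS.measurableSet]
    refine (Measure.comap_apply₀ (Subtype.val : C → ℕ → V) _ Subtype.val_injective himage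
      (hm hAS.measurableSet).nullMeasurableSet).trans (measure_congr ?_)
    filter_upwards [hconv] with X hX
    refine propext ?_
    have hev := hAS.eventually_iff X _ hX.choose_spec
    constructor
    · rintro ⟨Y, hY, rfl⟩
      exact hev.mono fun n hn => hn.2 hY
    · intro h
      obtain ⟨n, h1, h2⟩ := (hev.and h).exists
      exact ⟨⟨X, hX⟩, h1.1 h2, rfl⟩
  have hlim : Tendsto (fun n => chainLaw r x {X | X n ∈ A}) atTop (𝓝 (chainLaw r x E)) := by
    refine tendsto_measure_of_ae_tendsto_indicator_of_isFiniteMeasure atTop hEm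
      (fun n => measurable_pi_apply n (MeasurableSet.of_discrete (s := A))) ?_
    filter_upwards [hconv] with X hX
    obtain ⟨ω, hω⟩ := hX
    have hev := hAS.eventually_iff X ω hω
    have hXE : X ∈ E ↔ ω ∈ S := by
      constructor
      · intro h
        obtain ⟨n, h1, h2⟩ := (hev.and h).exists
        exact h1.1 h2
      · exact fun h => hev.mono fun n hn => hn.2 h
    filter_upwards [hev] with n hn
    exact hn.trans hXE.symm
  rw [Measure.real, hexit]
  refine ((ENNReal.tendsto_toReal (measure_ne_top _ _)).comp hlim).congr fun n => ?_
  rw [Function.comp_apply, chainLaw_apply hW hG hf hr, ENNReal.toReal_ofReal]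
  exact walkOp_pow_nonneg hW hG hf (Set.indicator_nonneg fun _ _ => zero_le_one) n x

end Walk

end VRJPTree

namespace VRJPTree

section Green

/-- A positive definite matrix with nonpositive off-diagonal entries has a nonnegative inverse. -/
theorem inv_nonneg_of_posDef {ι : Type*} [Fintype ι] [DecidableEq ι] {M : Matrix ι ι ℝ}
    (hM : M.PosDef) (hoff : ∀ i j, i ≠ j → M i j ≤ 0) (i j : ι) : 0 ≤ M⁻¹ i j := by
  set x : ι → ℝ := fun k => M⁻¹ k j
  set y : ι → ℝ := fun k => (x k)⁻
  set z : ι → ℝ := fun k => (x k)⁺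
  have hx : x = z - y := funext fun k => (posPart_sub_negPart (x k)).symm
  have hMx : ∀ k, 0 ≤ (M.mulVec x) k := by
    intro k
    have h : (M * M⁻¹) k j = (1 : Matrix ι ι ℝ) k j := by
      rw [Matrix.mul_nonsing_inv _ ((Matrix.isUnit_iff_isUnit_det _).1 hM.isUnit)]
    rw [Matrix.mul_apply, Matrix.one_apply] at h
    change 0 ≤ ∑ l, M k l * M⁻¹ l j
    rw [h]
    split_ifs <;> norm_num
  have h1 : 0 ≤ y ⬝ᵥ M.mulVec x :=
    Finset.sum_nonneg fun k _ => mul_nonneg (negPart_nonneg _) (hMx k)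
  have h2 : y ⬝ᵥ M.mulVec z ≤ 0 := by
    simp only [dotProduct, Matrix.mulVec, Finset.mul_sum]
    refine Finset.sum_nonpos fun k _ => Finset.sum_nonpos fun l _ => ?_
    by_cases hkl : k = l
    · subst hkl
      rcases le_total 0 (x k) with h | h
      · simp [y, negPart_eq_zero.2 h]
      · simp [z, posPart_eq_zero.2 h]
    · exact mul_nonpos_of_nonneg_of_nonpos (negPart_nonneg _)
        (mul_nonpos_of_nonpos_of_nonneg (hoff k l hkl) (posPart_nonneg _))
  have h3 : y = 0 := by
    by_contra hy
    have := hM.dotProduct_mulVec_pos hy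
    rw [hx, Matrix.mulVec_sub, dotProduct_sub] at h1
    simp only [star_trivial] at this
    linarith
  exact negPart_eq_zero.1 (congrFun h3 i)

theorem schrodingerBlock_apply_le {V : Type*} [DecidableEq V] {G : SimpleGraph V}
    {W : V → V → ℝ} {β : V → ℝ} (hW : IsConductance G W) (U : Finset V) (i j : U)
    (h : i ≠ j) :
    schrodingerBlock W β U i j ≤ 0 := by
  have hij : (i : V) ≠ j := fun h' => h (Subtype.ext h')
  simp only [schrodingerBlock, schrodinger, Matrix.submatrix_apply, Matrix.sub_apply,
    Matrix.diagonal_apply_ne _ hij, Matrix.of_apply, zero_sub, Left.neg_nonpos_iff]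
  by_cases hadj : G.Adj i j
  · exact (hW.pos _ _ hadj).le
  · exact (hW.zero _ _ hadj).ge

variable {V : Type*} {G : SimpleGraph V} [G.LocallyFinite] {φ : V} {W : V → V → ℝ} {β : V → ℝ}

/-- The Schrödinger operator `f ↦ 2βf - Wf`. -/
noncomputable def schrodingerOp (G : SimpleGraph V) [G.LocallyFinite] (W : V → V → ℝ) (β : V → ℝ)
    (f : V → ℝ) (i : V) : ℝ := 2 * β i * f i - adjSum G W f i

theorem adjSum_sum {ι : Type*} (s : Finset ι) (F : ι → V → ℝ) (a : ι → ℝ) (i : V) :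
    adjSum G W (fun k => ∑ y ∈ s, a y * F y k) i = ∑ y ∈ s, a y * adjSum G W (F y) i := by
  simp only [adjSum, Finset.mul_sum]
  rw [Finset.sum_comm]
  exact Finset.sum_congr rfl fun _ _ => Finset.sum_congr rfl fun _ _ => by ring

theorem adjSum_add (f g : V → ℝ) (i : V) :
    adjSum G W (fun k => f k + g k) i = adjSum G W f i + adjSum G W g i := by
  simp [adjSum, mul_add, Finset.sum_add_distrib]

theorem schrodingerOp_add (f g : V → ℝ) (i : V) :
    schrodingerOp G W β (fun k => f k + g k) i =
      schrodingerOp G W β f i + schrodingerOp G W β g i := by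
  simp only [schrodingerOp, adjSum_add]
  ring

theorem schrodingerOp_sum {ι : Type*} (s : Finset ι) (F : ι → V → ℝ) (a : ι → ℝ) (i : V) :
    schrodingerOp G W β (fun k => ∑ y ∈ s, a y * F y k) i =
      ∑ y ∈ s, a y * schrodingerOp G W β (F y) i := by
  simp only [schrodingerOp, adjSum_sum, mul_sub, Finset.sum_sub_distrib, Finset.mul_sum]
  congr 1
  exact Finset.sum_congr rfl fun _ _ => by ring

theorem tendsto_schrodingerOp {F : ℕ → V → ℝ} {f : V → ℝ}
    (h : ∀ j, Tendsto (fun n => F n j) atTop (𝓝 (f j))) (i : V) :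
    Tendsto (fun n => schrodingerOp G W β (F n) i) atTop (𝓝 (schrodingerOp G W β f i)) :=
  ((h i).const_mul _).sub (tendsto_finsetSum _ fun j _ => (h j).const_mul _)

variable [DecidableEq V]

theorem greenN_nonneg (hW : IsConductance G W) (hβ : β ∈ potentials W) (n : ℕ) (i j : V) :
    0 ≤ greenN G φ W β n i j := by
  unfold greenN
  split_ifs with h
  · exact inv_nonneg_of_posDef (hβ _) (schrodingerBlock_apply_le hW _) _ _
  · exact le_rfl

theorem greenN_of_notMem {n : ℕ} {i j : V} (hj : j ∉ ball G φ n) : greenN G φ W β n i j = 0 :=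
  dif_neg fun h => hj h.2

theorem greenN_comm (hβ : β ∈ potentials W) (n : ℕ) (i j : V) :
    greenN G φ W β n i j = greenN G φ W β n j i := by
  unfold greenN
  by_cases h : i ∈ ball G φ n ∧ j ∈ ball G φ n
  · rw [dif_pos h, dif_pos h.symm]
    have h1 := (hβ (ball G φ n)).isHermitian.inv
    simpa using h1.apply ⟨j, h.2⟩ ⟨i, h.1⟩
  · rw [dif_neg h, dif_neg fun h' => h h'.symm]

theorem schrodingerOp_greenN (hW : IsConductance G W) (hβ : β ∈ potentials W) {n : ℕ} {i : V}
    (hi : i ∈ ball G φ n) (j : V) :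
    schrodingerOp G W β (greenN G φ W β n j) i = if i = j then 1 else 0 := by
  by_cases hj : j ∈ ball G φ n
  swap
  · have h0 : ∀ k, greenN G φ W β n j k = 0 := fun k => dif_neg fun h => hj h.1
    rw [if_neg (by rintro rfl; exact hj hi)]
    simp [schrodingerOp, adjSum, h0]
  set M := schrodingerBlock W β (ball G φ n) with hM
  have h : (M⁻¹ * M) ⟨j, hj⟩ ⟨i, hi⟩ =
      (1 : Matrix (ball G φ n) (ball G φ n) ℝ) ⟨j, hj⟩ ⟨i, hi⟩ := by
    rw [Matrix.nonsing_inv_mul _ ((Matrix.isUnit_iff_isUnit_det _).1 (hβ _).isUnit)]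
  rw [Matrix.mul_apply, Matrix.one_apply] at h
  simp only [Subtype.mk.injEq] at h
  rw [show (if i = j then (1 : ℝ) else 0) = if j = i then 1 else 0 by simp [eq_comm], ← h]
  have h1 : ∀ k : ball G φ n, M⁻¹ ⟨j, hj⟩ k = greenN G φ W β n j k := fun k => by
    rw [greenN, dif_pos ⟨hj, k.2⟩]
  have h2 : ∀ k : ball G φ n, M k ⟨i, hi⟩ = (if (k : V) = i then 2 * β i else 0) - W i k := by
    intro k
    simp only [hM, schrodingerBlock, schrodinger, Matrix.submatrix_apply, Matrix.sub_apply,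
      Matrix.diagonal_apply, Matrix.of_apply, hW.symm i k]
    split_ifs with h <;> simp [h]
  simp only [h1, h2]
  rw [Finset.sum_coe_sort (ball G φ n)
    fun k => greenN G φ W β n j k * ((if k = i then 2 * β i else 0) - W i k)]
  simp only [mul_sub, Finset.sum_sub_distrib, mul_ite, mul_zero, Finset.sum_ite_eq', hi, if_true,
    schrodingerOp, adjSum]
  congr 1
  · ring
  · have hA : ∑ k ∈ G.neighborFinset i, W i k * greenN G φ W β n j k =
        ∑ k ∈ G.neighborFinset i ∪ ball G φ n, W i k * greenN G φ W β n j k :=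
      Finset.sum_subset Finset.subset_union_left fun k _ hk => by
        rw [SimpleGraph.mem_neighborFinset] at hk
        simp [hW.zero i k hk]
    have hB : ∑ k ∈ ball G φ n, W i k * greenN G φ W β n j k =
        ∑ k ∈ G.neighborFinset i ∪ ball G φ n, W i k * greenN G φ W β n j k :=
      Finset.sum_subset Finset.subset_union_right fun k _ hk => by
        simp [greenN_of_notMem hk]
    rw [hA, ← hB]
    exact Finset.sum_congr rfl fun k _ => mul_comm _ _

theorem schrodingerOp_psiN (hW : IsConductance G W) (hβ : β ∈ potentials W) {n : ℕ} {i : V}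
    (hi : i ∈ ball G φ n) : schrodingerOp G W β (psiN G φ W β n) i = 0 := by
  have h : psiN G φ W β n = fun k =>
      (∑ j ∈ ball G φ n, etaN G φ W n j * greenN G φ W β n j k) +
        if k ∈ ball G φ n then 0 else 1 := by
    ext k
    unfold psiN
    by_cases hk : k ∈ ball G φ n
    · simp only [if_pos hk, add_zero]
      exact Finset.sum_congr rfl fun j _ => by rw [greenN_comm hβ n k j, mul_comm]
    · simp [hk, greenN_of_notMem hk]
  have h2 : schrodingerOp G W β (fun k => if k ∈ ball G φ n then 0 else 1) i =
      - etaN G φ W n i := by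
    simp only [schrodingerOp, adjSum, etaN, hi, if_true, mul_zero, zero_sub, Finset.sum_filter]
    congr 1
    exact Finset.sum_congr rfl fun k _ => by split_ifs <;> simp
  rw [h, schrodingerOp_add, schrodingerOp_sum, h2]
  simp [schrodingerOp_greenN hW hβ hi, hi]

theorem tendsto_greenN (hlim : LimitsExist G φ W β) (i j : V) :
    Tendsto (fun n => greenN G φ W β n i j) atTop (𝓝 (green G φ W β i j)) :=
  tendsto_nhds_limUnder (hlim.1 i j)

theorem tendsto_psiN (hlim : LimitsExist G φ W β) (i : V) :
    Tendsto (fun n => psiN G φ W β n i) atTop (𝓝 (psi G φ W β i)) :=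
  tendsto_nhds_limUnder (hlim.2 i)

theorem eventually_mem_ball (hG : G.Connected) (i : V) : ∀ᶠ n in atTop, i ∈ ball G φ n := by
  filter_upwards [eventually_ge_atTop (G.dist φ i)] with n hn
  exact (mem_ball_iff G φ hG n i).2 hn

theorem schrodingerOp_green (hG : G.Connected) (hW : IsConductance G W) (hβ : β ∈ potentials W)
    (hlim : LimitsExist G φ W β) (i j : V) :
    schrodingerOp G W β (green G φ W β j) i = if i = j then 1 else 0 := by
  refine tendsto_nhds_unique (tendsto_schrodingerOp (fun k => tendsto_greenN hlim j k) i)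
    (tendsto_const_nhds.congr' ?_)
  filter_upwards [eventually_mem_ball hG i] with n hn
  exact (schrodingerOp_greenN hW hβ hn j).symm

theorem schrodingerOp_psi (hG : G.Connected) (hW : IsConductance G W) (hβ : β ∈ potentials W)
    (hlim : LimitsExist G φ W β) (i : V) : schrodingerOp G W β (psi G φ W β) i = 0 := by
  refine tendsto_nhds_unique (tendsto_schrodingerOp (fun k => tendsto_psiN hlim k) i)
    (tendsto_const_nhds.congr' ?_)
  filter_upwards [eventually_mem_ball hG i] with n hn
  exact (schrodingerOp_psiN hW hβ hn).symm

theorem green_nonneg (hW : IsConductance G W) (hβ : β ∈ potentials W)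
    (hlim : LimitsExist G φ W β) (i j : V) : 0 ≤ green G φ W β i j :=
  ge_of_tendsto' (tendsto_greenN hlim i j) fun n => greenN_nonneg hW hβ n i j

theorem green_root_pos (hG : G.Connected) (hW : IsConductance G W) (hβ : β ∈ potentials W)
    (hlim : LimitsExist G φ W β) (j : V) : 0 < green G φ W β φ j := by
  have hnn := green_nonneg hW hβ hlim φ
  have hterm : ∀ i, ∀ k ∈ G.neighborFinset i, 0 ≤ W i k * green G φ W β φ k := fun i k hk => by
    rw [SimpleGraph.mem_neighborFinset] at hk
    exact mul_nonneg (hW.pos i k hk).le (hnn k)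
  have hstep : ∀ i k, G.Adj i k → 0 < green G φ W β φ i → 0 < green G φ W β φ k := by
    intro i k hik hi
    refine (hnn k).lt_of_ne' fun h0 => ?_
    have h := schrodingerOp_green hG hW hβ hlim k φ
    have h1 : W k i * green G φ W β φ i ≤ adjSum G W (green G φ W β φ) k :=
      Finset.single_le_sum (hterm k) (by simpa using hik.symm)
    have h2 := mul_pos (hW.pos k i hik.symm) hi
    rw [schrodingerOp, h0] at h
    split_ifs at h <;> linarith
  have hroot : 0 < green G φ W β φ φ := by
    refine (hnn φ).lt_of_ne' fun h0 => ?_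
    have h := schrodingerOp_green hG hW hβ hlim φ φ
    have h1 : 0 ≤ adjSum G W (green G φ W β φ) φ := Finset.sum_nonneg (hterm φ)
    rw [schrodingerOp, h0, if_pos rfl] at h
    linarith
  obtain ⟨p⟩ := hG.preconnected φ j
  have : ∀ {a b : V} (_ : G.Walk a b), 0 < green G φ W β φ a → 0 < green G φ W β φ b := by
    intro a b p
    induction p with
    | nil => exact id
    | cons h _ ih => exact fun ha => ih (hstep _ _ h ha)
  exact this p hroot

theorem ray_apply_mem_generation {m : ℕ} (hT : G.IsTree) (ω : Ends G φ) :
    ω.1 m ∈ generation G φ m := by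
  simp [generation, mem_ball_iff G φ hT.connected, ray_dist hT]

end Green

end VRJPTree

namespace VRJPTree

section DoobTransform

variable {V : Type*} {G : SimpleGraph V} [G.LocallyFinite] {φ : V} {W : V → V → ℝ} {β : V → ℝ}
  {u : V → ℝ}

theorem adjSum_eq (f : V → ℝ) (i : V) :
    adjSum G W f i = 2 * β i * f i - schrodingerOp G W β f i := by
  simp [schrodingerOp]

theorem walkOp_div (hu : ∀ i, 0 < u i)
    (f : V → ℝ) (i : V) :
    walkOp G W u (fun j => f j / u j) i =
      (2 * β i * f i - schrodingerOp G W β f i) / (2 * β i * u i - schrodingerOp G W β u i) := by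
  rw [walkOp_apply, ← adjSum_eq, ← adjSum_eq]
  congr 2
  ext j
  have := (hu j).ne'
  field_simp

/-- The transition operator of the transform of a Green function `u` with pole `φ`, applied to
a function which is harmonic except at `φ`. -/
theorem walkOp_div_of_schrodingerOp (hW : IsConductance G W) (hG : ∀ x, ∃ y, G.Adj x y)
    (hu : ∀ i, 0 < u i) [DecidableEq V]
    (hHu : ∀ i, schrodingerOp G W β u i = if i = φ then 1 else 0) {f : V → ℝ} {e : ℝ} {i : V}
    (hf : schrodingerOp G W β f i = if i = φ then e else 0) :
    walkOp G W u (fun j => f j / u j) i =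
      f i / u i + (f φ - e * u φ) / (u φ * adjSum G W u φ) * Set.indicator {φ} 1 i := by
  have hpos := adjSum_pos hW hG hu i
  have hui := hu i
  rw [walkOp_div (β := β) hu, hf, hHu]
  rw [adjSum_eq (β := β), hHu] at hpos
  by_cases h : i = φ
  · subst h
    rw [adjSum_eq (β := β), hHu]
    simp only [if_true, Set.indicator_of_mem, Set.mem_singleton_iff, Pi.one_apply, mul_one] at *
    field_simp
    ring
  · simp only [h, if_false, sub_zero, Set.indicator_of_notMem, Set.mem_singleton_iff, mul_zero,
      add_zero, not_false_eq_true] at *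
    have : β i ≠ 0 := by rintro h0; simp [h0] at hpos
    field_simp

theorem walkOp_pow_of_walkOp_eq {g δ : V → ℝ} {d : ℝ} (h : walkOp G W u g = g + d • δ) (n : ℕ) :
    (walkOp G W u ^ n) g = g + d • ∑ k ∈ Finset.range n, (walkOp G W u ^ k) δ := by
  induction n with
  | zero => simp
  | succ n ih =>
    rw [pow_succ, Module.End.mul_apply, h, map_add, ih, map_smul, Finset.sum_range_succ, smul_add,
      add_assoc]

theorem le_walkOp_pow_of_le_walkOp (hW : IsConductance G W) (hG : ∀ x, ∃ y, G.Adj x y)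
    (hu : ∀ i, 0 < u i) {g δ : V → ℝ} {d : ℝ} (h : g + d • δ ≤ walkOp G W u g) (n : ℕ) :
    g + d • ∑ k ∈ Finset.range n, (walkOp G W u ^ k) δ ≤ (walkOp G W u ^ n) g := by
  induction n with
  | zero => simp
  | succ n ih =>
    rw [pow_succ, Module.End.mul_apply]
    refine le_trans ?_ (walkOp_pow_mono hW hG hu h n)
    rw [map_add, map_smul, Finset.sum_range_succ, smul_add, ← add_assoc]
    exact add_le_add ih le_rfl

/-- The expectation of `f(X_n)/u(X_n)` for `f` harmonic except at `φ`. -/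
theorem tendsto_walkOp_pow_div (hW : IsConductance G W) (hG : ∀ x, ∃ y, G.Adj x y)
    (hu : ∀ i, 0 < u i) [DecidableEq V]
    (hHu : ∀ i, schrodingerOp G W β u i = if i = φ then 1 else 0) {f : V → ℝ} {e : ℝ}
    (hf : ∀ i, schrodingerOp G W β f i = if i = φ then e else 0)
    (hS : Summable fun n => (walkOp G W u ^ n) (Set.indicator {φ} 1) φ) :
    Tendsto (fun n => (walkOp G W u ^ n) (fun j => f j / u j) φ) atTop
      (𝓝 (f φ / u φ + (f φ - e * u φ) / (u φ * adjSum G W u φ) *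
        ∑' n, (walkOp G W u ^ n) (Set.indicator {φ} 1) φ)) := by
  have h : walkOp G W u (fun j => f j / u j) = (fun j => f j / u j) +
      ((f φ - e * u φ) / (u φ * adjSum G W u φ)) • Set.indicator {φ} 1 :=
    funext fun i => walkOp_div_of_schrodingerOp hW hG hu hHu (hf i)
  simp only [walkOp_pow_of_walkOp_eq h, Pi.add_apply, Pi.smul_apply, Finset.sum_apply, smul_eq_mul]
  exact (hS.hasSum.tendsto_sum_nat.const_mul _).const_add _

/-- For a transient walk, the ratio of the minimal Green function to the Green function `u` tends
to zero in mean. -/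
theorem tendsto_walkOp_pow_green_div [DecidableEq V] (hG : G.Connected) (hG' : ∀ x, ∃ y, G.Adj x y)
    (hW : IsConductance G W) (hβ : β ∈ potentials W) (hlim : LimitsExist G φ W β)
    (hu : ∀ i, 0 < u i) (hHu : ∀ i, schrodingerOp G W β u i = if i = φ then 1 else 0)
    (hS : ∀ y, Summable fun n => (walkOp G W u ^ n) (Set.indicator {y} 1) φ) :
    Tendsto (fun n => (walkOp G W u ^ n) (fun j => green G φ W β φ j / u j) φ) atTop (𝓝 0) := by
  have hlimit := tendsto_walkOp_pow_div hW hG' hu hHu (e := 1)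
    (fun i => schrodingerOp_green hG hW hβ hlim i φ) (hS φ)
  set S := ∑' n, (walkOp G W u ^ n) (Set.indicator {φ} 1) φ
  refine (hlimit.trans (le_of_eq (congrArg 𝓝 (le_antisymm ?_ ?_))))
  · have hN : ∀ N, greenN G φ W β N φ φ / u φ +
        (greenN G φ W β N φ φ - 1 * u φ) / (u φ * adjSum G W u φ) * S ≤ 0 := by
      intro N
      set g : V → ℝ := fun j => greenN G φ W β N φ j / u j with hg
      have hsuper : g + ((greenN G φ W β N φ φ - 1 * u φ) / (u φ * adjSum G W u φ)) •
          Set.indicator {φ} 1 ≤ walkOp G W u g := by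
        intro i
        by_cases hi : i ∈ ball G φ N
        · exact (walkOp_div_of_schrodingerOp hW hG' hu hHu
            (schrodingerOp_greenN hW hβ hi φ)).ge
        · have hiφ : i ≠ φ := by
            rintro rfl
            exact hi ((mem_ball_iff G i hG N i).2 (by simp))
          have h0 : 0 ≤ walkOp G W u g i := by
            have := walkOp_pow_nonneg hW hG' hu (g := g)
              (fun j => div_nonneg (greenN_nonneg hW hβ N φ j) (hu j).le) 1 i
            simpa using this
          simpa [hg, greenN_of_notMem hi, hiφ] using h0
      have hgsum : g = ∑ y ∈ ball G φ N, g y • Set.indicator {y} (1 : V → ℝ) := by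
        ext i
        simp only [Finset.sum_apply, Pi.smul_apply, smul_eq_mul, Set.indicator_apply,
          Set.mem_singleton_iff, Pi.one_apply, mul_ite, mul_one, mul_zero, Finset.sum_ite_eq]
        split_ifs with h
        · rfl
        · simp [hg, greenN_of_notMem h]
      have hzero : Tendsto (fun n => (walkOp G W u ^ n) g φ) atTop (𝓝 0) := by
        rw [hgsum]
        simp only [map_sum, map_smul, Finset.sum_apply, Pi.smul_apply, smul_eq_mul]
        simpa using tendsto_finsetSum (ball G φ N)
          fun y _ => (hS y).tendsto_atTop_zero.const_mul (g y)
      refine le_of_tendsto_of_tendsto'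
        (((hS φ).hasSum.tendsto_sum_nat.const_mul _).const_add _) hzero fun n => ?_
      have := le_walkOp_pow_of_le_walkOp hW hG' hu hsuper n φ
      simpa [hg] using this
    have ht := tendsto_greenN hlim φ φ
    exact le_of_tendsto' ((ht.div_const _).add (((ht.sub_const _).div_const _).mul_const _)) hN
  · exact ge_of_tendsto' hlimit fun n => walkOp_pow_nonneg hW hG' hu
      (fun j => div_nonneg (green_nonneg hW hβ hlim φ j) (hu j).le) n φ

end DoobTransform

section Chi

variable {V : Type*} [DecidableEq V] {G : SimpleGraph V} [G.LocallyFinite] {φ : V}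
  {W : V → V → ℝ} {β : V → ℝ}

theorem isWalkRate_cPsi (hψ : ∀ k, 0 < psi G φ W β k) :
    IsWalkRate W (psi G φ W β) (cPsi G φ W β) :=
  ⟨psi G φ W β, hψ, fun i j => by rw [cPsi]; ring⟩

variable [MeasurableSpace V] [DiscreteMeasurableSpace V]

instance [Countable V] (r : V → V → ℝ) (x : V) : IsFiniteMeasure (exitMeasure G φ r x) := by
  unfold exitMeasure; infer_instance

instance [Countable V] (i : V) : IsFiniteMeasure (chi G φ W β i) := by
  unfold chi harmonicMeasure
  split_ifs
  · exact Measure.smul_finite _ ENNReal.ofReal_ne_top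
  · exact Measure.smul_finite _ ENNReal.ofReal_ne_top

variable (G φ W β) in
theorem chi_cases : (∀ i, chi G φ W β i = 0) ∨
    (∀ k, 0 < psi G φ W β k) ∧ IsTransient (cPsi G φ W β) ∧
      ∀ i S, (chi G φ W β i).real S =
        psi G φ W β i * (exitMeasure G φ (cPsi G φ W β) i).real S := by
  by_cases h : (∀ k, 0 < psi G φ W β k) ∧ IsTransient (cPsi G φ W β)
  · refine Or.inr ⟨h.1, h.2, fun i S => ?_⟩
    rw [chi, harmonicMeasure, if_pos h, measureReal_ennreal_smul_apply,
      ENNReal.toReal_ofReal (h.1 i).le]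
  · exact Or.inl fun i => by rw [chi, harmonicMeasure, if_neg h, smul_zero]

theorem schrodingerOp_chi [Countable V] (hT : G.IsTree) (hG : ∀ x, ∃ y, G.Adj x y)
    (hW : IsConductance G W) (hβ : β ∈ potentials W) (hlim : LimitsExist G φ W β) {A : Set V}
    {S : Set (Ends G φ)} (hAS : IsTraceOf G φ A S) (i : V) :
    schrodingerOp G W β (fun j => (chi G φ W β j).real S) i = 0 := by
  rcases chi_cases G φ W β with h | ⟨hψ, ht, h⟩
  · simp [h, schrodingerOp, adjSum]
  simp only [h]
  have hr := isWalkRate_cPsi hψ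
  set a : V → ℝ := fun j => (exitMeasure G φ (cPsi G φ W β) j).real S with ha
  have hconv : ∀ j, Tendsto
      (fun n => (walkOp G W (psi G φ W β) ^ n) (A.indicator 1) j) atTop (𝓝 (a j)) :=
    fun j => tendsto_exitMeasure hT hW hG hψ hr ht hAS j
  have hfix : walkOp G W (psi G φ W β) a i = a i := by
    refine tendsto_nhds_unique (f := fun n =>
      (walkOp G W (psi G φ W β) ^ (n + 1)) (A.indicator 1) i) ?_
      ((hconv i).comp (tendsto_add_atTop_nat 1))
    simp only [pow_succ', Module.End.mul_apply, walkOp_apply]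
    exact (tendsto_finsetSum _ fun j _ => ((hconv j).const_mul _).const_mul _).div_const _
  have hpos := adjSum_pos hW hG hψ i
  rw [walkOp_apply, div_eq_iff hpos.ne', adjSum_eq (β := β) (psi G φ W β),
    schrodingerOp_psi hT.connected hW hβ hlim] at hfix
  rw [schrodingerOp, hfix]
  ring

/-- The charge of the ends reached through a set of vertices with finite boundary is
dominated, outside of this set, by the minimal Green function. -/
theorem chi_le_green [Countable V] (hT : G.IsTree) (hG : ∀ x, ∃ y, G.Adj x y)
    (hW : IsConductance G W) (hβ : β ∈ potentials W) (hlim : LimitsExist G φ W β) {A : Set V}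
    {S : Set (Ends G φ)} (hAS : IsTraceOf G φ A S) (F : Finset V)
    (hF : ∀ j k, G.Adj j k → j ∉ A → k ∈ A → k ∈ F) :
    ∃ C, 0 ≤ C ∧ ∀ j ∉ A, (chi G φ W β j).real S ≤ C * green G φ W β φ j := by
  rcases chi_cases G φ W β with h | ⟨hψ, ht, h⟩
  · exact ⟨0, le_rfl, fun j _ => by simp [h]⟩
  have hr := isWalkRate_cPsi hψ
  have hgreen := green_root_pos hT.connected hW hβ hlim
  set s : V → ℝ := fun j => green G φ W β φ j / psi G φ W β j with hs
  have hspos : ∀ j, 0 < s j := fun j => div_pos (hgreen j) (hψ j)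
  have hsuper : walkOp G W (psi G φ W β) s ≤ s := by
    intro i
    have hpos := adjSum_pos hW hG hψ i
    rw [adjSum_eq (β := β), schrodingerOp_psi hT.connected hW hβ hlim, sub_zero] at hpos
    rw [hs, walkOp_div (β := β) hψ, schrodingerOp_psi hT.connected hW hβ hlim,
      schrodingerOp_green hT.connected hW hβ hlim, sub_zero, div_le_div_iff₀ hpos (hψ i)]
    have := hψ i
    split_ifs <;> nlinarith
  set C := ∑ k ∈ F, 1 / s k
  have hC0 : 0 ≤ C := Finset.sum_nonneg fun k _ => (one_div_pos.2 (hspos k)).le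
  have hC : ∀ k ∈ F, 1 ≤ C * s k := by
    intro k hk
    have : 1 / s k ≤ C := Finset.single_le_sum (f := fun k => 1 / s k)
      (fun k _ => (one_div_pos.2 (hspos k)).le) hk
    exact (div_le_iff₀ (hspos k)).1 this
  have hle1 : ∀ n, (walkOp G W (psi G φ W β) ^ n) (A.indicator 1) ≤ 1 := fun n => by
    conv_rhs => rw [← walkOp_pow_one hW hG hψ n]
    exact walkOp_pow_mono hW hG hψ (Set.indicator_le_self' fun _ _ => zero_le_one) n
  have hbound : ∀ n, ∀ j ∉ A,
      (walkOp G W (psi G φ W β) ^ n) (A.indicator 1) j ≤ C * s j := by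
    intro n
    induction n with
    | zero => exact fun j hj => by simpa [hj] using mul_nonneg hC0 (hspos j).le
    | succ n ih =>
      intro j hj
      rw [pow_succ', Module.End.mul_apply]
      calc _ ≤ walkOp G W (psi G φ W β) (C • s) j := walkOp_mono hW hG hψ fun k hk => by
            by_cases hkA : k ∈ A
            · exact (hle1 n k).trans (hC k (hF j k hk hj hkA))
            · exact ih k hkA
        _ ≤ C * s j := by
            rw [map_smul]
            exact mul_le_mul_of_nonneg_left (hsuper j) hC0
  refine ⟨C, hC0, fun j hj => ?_⟩
  have h1 := le_of_tendsto' (tendsto_exitMeasure hT hW hG hψ hr ht hAS j) fun n => hbound n j hj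
  rw [h]
  calc _ ≤ psi G φ W β j * (C * s j) := mul_le_mul_of_nonneg_left h1 (hψ j).le
    _ = C * green G φ W β φ j := by
      have := (hψ j).ne'
      simp only [hs]
      field_simp

end Chi

end VRJPTree

namespace VRJPTree

section Boundary

variable {V : Type*} [DecidableEq V] {G : SimpleGraph V} [G.LocallyFinite] {φ : V}
  {W : V → V → ℝ} {β : V → ℝ} [MeasurableSpace V] [DiscreteMeasurableSpace V]
  {m : ℕ} {ρ : generation G φ m → ℝ}

theorem checkGreen_nonneg (hW : IsConductance G W) (hβ : β ∈ potentials W)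
    (hlim : LimitsExist G φ W β) (hρ : ρ ∈ boundaryPotentials G φ W β m)
    (y y' : generation G φ m) : 0 ≤ checkGreen G φ W β ρ y y' := by
  refine inv_nonneg_of_posDef hρ (fun i j hij => ?_) y y'
  simp only [schrodinger, Matrix.sub_apply, Matrix.diagonal_apply_ne _ hij, Matrix.of_apply,
    zero_sub, Left.neg_nonpos_iff, checkC, if_neg hij]
  exact div_nonneg (mul_nonneg measureReal_nonneg measureReal_nonneg)
    (green_nonneg hW hβ hlim _ _)

theorem checkg_eq_sum (hT : G.IsTree) :
    (fun p : Ends G φ × Ends G φ => checkg G φ W β ρ p.1 p.2) = fun p => ∑ y, ∑ y',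
      checkGreen G φ W β ρ y y' *
        (endsThrough (y : V) ×ˢ endsThrough (y' : V)).indicator (fun _ => 1) p := by
  ext ⟨ω, τ⟩
  have hmem : ∀ (ω : Ends G φ) (y : generation G φ m),
      ω ∈ endsThrough (y : V) ↔ y = ⟨ω.1 m, ray_apply_mem_generation hT ω⟩ := by
    intro ω y
    have hy : G.dist φ (y : V) = m := (Finset.mem_filter.1 y.2).2
    rw [← ray_apply_eq_iff hT ω hy, Subtype.ext_iff]
    exact eq_comm
  have hind : ∀ y y' : generation G φ m,
      ((endsThrough (y : V) : Set (Ends G φ)) ×ˢ (endsThrough (y' : V) : Set (Ends G φ))).indicator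
        (fun _ => (1 : ℝ)) (ω, τ) = if y = ⟨ω.1 m, ray_apply_mem_generation hT ω⟩ then
          if y' = ⟨τ.1 m, ray_apply_mem_generation hT τ⟩ then 1 else 0 else 0 := by
    intro y y'
    have hp : (ω, τ) ∈ (endsThrough (y : V) : Set (Ends G φ)) ×ˢ
        (endsThrough (y' : V) : Set (Ends G φ)) ↔ y = ⟨ω.1 m, ray_apply_mem_generation hT ω⟩ ∧
          y' = ⟨τ.1 m, ray_apply_mem_generation hT τ⟩ := by
      rw [Set.mem_prod, hmem, hmem]
    rw [← ite_and]
    split_ifs with h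
    · exact Set.indicator_of_mem (hp.2 h) _
    · exact Set.indicator_of_notMem (fun h' => h (hp.1 h')) _
  simp only [hind, checkg, ray_apply_mem_generation hT, and_self, dif_pos, mul_ite, mul_one,
    mul_zero]
  simp

theorem integrable_checkg (hT : G.IsTree) (μ ν : Measure (Ends G φ)) [IsFiniteMeasure μ]
    [IsFiniteMeasure ν] :
    Integrable (fun p : Ends G φ × Ends G φ => checkg G φ W β ρ p.1 p.2) (μ.prod ν) := by
  rw [checkg_eq_sum hT]
  exact integrable_finsetSum _ fun y _ => integrable_finsetSum _ fun y' _ =>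
    (((integrable_const (1 : ℝ)).indicator ((measurableSet_endsThrough φ _).prod
      (measurableSet_endsThrough φ _))).const_mul _)

theorem integral_checkg (hT : G.IsTree) (μ ν : Measure (Ends G φ)) [IsFiniteMeasure μ]
    [IsFiniteMeasure ν] :
    ∫ p, checkg G φ W β ρ p.1 p.2 ∂(μ.prod ν) = ∑ y : generation G φ m,
      ∑ y' : generation G φ m, checkGreen G φ W β ρ y y' *
        (μ.real (endsThrough (y : V)) * ν.real (endsThrough (y' : V))) := by
  have hm : ∀ y y' : V, MeasurableSet
      ((endsThrough y : Set (Ends G φ)) ×ˢ (endsThrough y' : Set (Ends G φ))) := fun y y' =>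
    (measurableSet_endsThrough φ y).prod (measurableSet_endsThrough φ y')
  have hi : ∀ y y' : generation G φ m, Integrable (fun p => checkGreen G φ W β ρ y y' *
      ((endsThrough (y : V) : Set (Ends G φ)) ×ˢ (endsThrough (y' : V) : Set (Ends G φ))).indicator
        (fun _ => (1 : ℝ)) p) (μ.prod ν) := fun y y' =>
    ((integrable_const (1 : ℝ)).indicator (hm _ _)).const_mul _
  rw [checkg_eq_sum hT, integral_finsetSum _ fun y _ => integrable_finsetSum _ fun y' _ => hi y y']
  refine Finset.sum_congr rfl fun y _ => ?_
  rw [integral_finsetSum _ fun y' _ => hi y y']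
  refine Finset.sum_congr rfl fun y' _ => ?_
  rw [integral_const_mul, integral_indicator_const _ (hm _ _), measureReal_prod_prod]
  simp

variable (G φ W β ρ) in
/-- The density `y' ↦ ∑_y χ(φ,Ω_y) Ǧ(y,y')` on the generation `m`. -/
noncomputable def boundaryWeight (y' : generation G φ m) : ℝ :=
  ∑ y : generation G φ m, checkGreen G φ W β ρ y y' * (chi G φ W β φ).real (endsThrough (y : V))

variable (G φ W β ρ) in
/-- `∫_{Ω × S} χ(φ,dω) ǧ(ω,τ) χ(j,dτ)`. -/
noncomputable def boundaryGreen (S : Set (Ends G φ)) (j : V) : ℝ :=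
  ∑ y' : generation G φ m, boundaryWeight G φ W β ρ y' *
    (chi G φ W β j).real (endsThrough (y' : V) ∩ S)

theorem boundaryWeight_nonneg (hW : IsConductance G W) (hβ : β ∈ potentials W)
    (hlim : LimitsExist G φ W β) (hρ : ρ ∈ boundaryPotentials G φ W β m)
    (y : generation G φ m) : 0 ≤ boundaryWeight G φ W β ρ y :=
  Finset.sum_nonneg fun _ _ => mul_nonneg (checkGreen_nonneg hW hβ hlim hρ _ _) measureReal_nonneg

theorem boundaryGreen_nonneg (hW : IsConductance G W) (hβ : β ∈ potentials W)
    (hlim : LimitsExist G φ W β) (hρ : ρ ∈ boundaryPotentials G φ W β m) (S : Set (Ends G φ))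
    (j : V) : 0 ≤ boundaryGreen G φ W β ρ S j :=
  Finset.sum_nonneg fun y _ =>
    mul_nonneg (boundaryWeight_nonneg hW hβ hlim hρ y) measureReal_nonneg

variable [Countable V]

theorem setIntegral_checkg (hT : G.IsTree) (S : Set (Ends G φ)) (j : V) :
    ∫ p in Set.univ ×ˢ S, checkg G φ W β ρ p.1 p.2 ∂((chi G φ W β φ).prod (chi G φ W β j)) =
      boundaryGreen G φ W β ρ S j := by
  rw [← Measure.prod_restrict, Measure.restrict_univ, integral_checkg hT, Finset.sum_comm]
  refine Finset.sum_congr rfl fun y' _ => ?_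
  rw [boundaryWeight, Finset.sum_mul]
  refine Finset.sum_congr rfl fun y _ => ?_
  rw [measureReal_restrict_apply (measurableSet_endsThrough φ _), mul_assoc]

theorem greenM_root (hT : G.IsTree) (j : V) :
    greenM G φ W β ρ φ j = green G φ W β φ j + boundaryGreen G φ W β ρ Set.univ j := by
  rw [greenM, ← setIntegral_checkg hT, Set.univ_prod_univ, Measure.restrict_univ]

theorem schrodingerOp_boundaryGreen (hT : G.IsTree) (hG : ∀ x, ∃ y, G.Adj x y)
    (hW : IsConductance G W) (hβ : β ∈ potentials W) (hlim : LimitsExist G φ W β) {A : Set V}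
    {S : Set (Ends G φ)} (hAS : IsTraceOf G φ A S) (i : V) :
    schrodingerOp G W β (boundaryGreen G φ W β ρ S) i = 0 := by
  have := schrodingerOp_sum (G := G) (W := W) (β := β) Finset.univ
    (fun (y' : generation G φ m) j => (chi G φ W β j).real (endsThrough (y' : V) ∩ S))
    (boundaryWeight G φ W β ρ) i
  refine this.trans (Finset.sum_eq_zero fun y' _ => ?_)
  rw [schrodingerOp_chi hT hG hW hβ hlim ((isTraceOf_endsThrough hT φ _).inter hAS), mul_zero]

theorem boundaryGreen_le (hW : IsConductance G W) (hβ : β ∈ potentials W)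
    (hlim : LimitsExist G φ W β) (hρ : ρ ∈ boundaryPotentials G φ W β m) (S : Set (Ends G φ))
    (j : V) : boundaryGreen G φ W β ρ S j ≤
      (∑ y, boundaryWeight G φ W β ρ y) * (chi G φ W β j).real S := by
  rw [Finset.sum_mul]
  exact Finset.sum_le_sum fun y _ => mul_le_mul_of_nonneg_left
    (measureReal_mono Set.inter_subset_right) (boundaryWeight_nonneg hW hβ hlim hρ y)

theorem boundaryGreen_add_compl {S : Set (Ends G φ)} (hS : MeasurableSet S) (j : V) :
    boundaryGreen G φ W β ρ S j + boundaryGreen G φ W β ρ Sᶜ j =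
      boundaryGreen G φ W β ρ Set.univ j := by
  simp only [boundaryGreen, ← Finset.sum_add_distrib, ← mul_add, Set.inter_univ]
  refine Finset.sum_congr rfl fun y _ => ?_
  rw [← Set.sdiff_eq, measureReal_inter_add_sdiff hS]

/-- Up to a multiple of the minimal Green function, `boundaryGreen` of the ends through `x` is
`G_m(φ,·)` on the branch of `x`, and zero outside of it. -/
theorem abs_indicator_sub_boundaryGreen_le (hT : G.IsTree) (hG : ∀ x, ∃ y, G.Adj x y)
    (hW : IsConductance G W) (hβ : β ∈ potentials W) (hlim : LimitsExist G φ W β)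
    (hρ : ρ ∈ boundaryPotentials G φ W β m) (x : V) :
    ∃ C, ∀ j, |Set.indicator {y | IsAncestor G φ x y} (greenM G φ W β ρ φ) j -
      boundaryGreen G φ W β ρ (endsThrough x) j| ≤ C * green G φ W β φ j := by
  have htr := isTraceOf_endsThrough hT φ x
  obtain ⟨C₁, hC₁, h₁⟩ := chi_le_green hT hG hW hβ hlim htr {x}
    fun j k hjk hj hk => Finset.mem_singleton.2 (eq_of_adj_of_isAncestor hT hjk hj hk)
  obtain ⟨C₂, hC₂, h₂⟩ := chi_le_green hT hG hW hβ hlim htr.compl (G.neighborFinset x)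
    fun j k hjk hj hk => by
      have := eq_of_adj_of_isAncestor hT hjk.symm hk (not_not.1 hj)
      subst this
      simpa using hjk
  set B := ∑ y, boundaryWeight G φ W β ρ y
  have hB : 0 ≤ B := Finset.sum_nonneg fun y _ => boundaryWeight_nonneg hW hβ hlim hρ y
  refine ⟨1 + B * C₂ + B * C₁, fun j => ?_⟩
  have hg := green_nonneg hW hβ hlim φ j
  have hg₁ := mul_nonneg (mul_nonneg hB hC₁) hg
  have hg₂ := mul_nonneg (mul_nonneg hB hC₂) hg
  by_cases hj : j ∈ {y | IsAncestor G φ x y}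
  · have hle := (boundaryGreen_le hW hβ hlim hρ (endsThrough x)ᶜ j).trans
      (mul_le_mul_of_nonneg_left (h₂ j (not_not.2 hj)) hB)
    have hnn := boundaryGreen_nonneg hW hβ hlim hρ (endsThrough x)ᶜ j
    rw [Set.indicator_of_mem hj, greenM_root hT,
      ← boundaryGreen_add_compl (measurableSet_endsThrough φ x), abs_of_nonneg (by linarith)]
    linarith
  · have hle := (boundaryGreen_le hW hβ hlim hρ (endsThrough x) j).trans
      (mul_le_mul_of_nonneg_left (h₁ j hj) hB)
    have hnn := boundaryGreen_nonneg hW hβ hlim hρ (endsThrough x) j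
    rw [Set.indicator_of_notMem hj, zero_sub, abs_neg, abs_of_nonneg hnn]
    linarith

end Boundary

end VRJPTree

open VRJPTree in
theorem proposition8p3 {V : Type*} [DecidableEq V] [Infinite V]
    [MeasurableSpace V] [DiscreteMeasurableSpace V]
    (G : SimpleGraph V) [G.LocallyFinite] (hG : G.IsTree) (φ : V)
    (W : V → V → ℝ) (hW : IsConductance G W)
    (β : V → ℝ) (hβ : β ∈ potentials W) (hlim : LimitsExist G φ W β)
    (m : ℕ) (ρ : generation G φ m → ℝ) (hρ : ρ ∈ boundaryPotentials G φ W β m)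
    (htrans : IsTransient (rate G φ W β ρ φ)) :
    Integrable (fun p : Ends G φ × Ends G φ => checkg G φ W β ρ p.1 p.2)
        ((chi G φ W β φ).prod (chi G φ W β φ)) ∧
      0 < ∫ p, checkg G φ W β ρ p.1 p.2 ∂((chi G φ W β φ).prod (chi G φ W β φ)) ∧
      ∀ x : V, (exitMeasure G φ (rate G φ W β ρ φ) φ).real (endsThrough x) =
        (∫ p in Set.univ ×ˢ endsThrough x, checkg G φ W β ρ p.1 p.2
            ∂((chi G φ W β φ).prod (chi G φ W β φ))) /
          ∫ p, checkg G φ W β ρ p.1 p.2 ∂((chi G φ W β φ).prod (chi G φ W β φ)) := by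
  have : Countable V := countable_of_locallyFinite hG.connected φ
  have hadj := exists_adj hG
  set u := greenM G φ W β ρ φ with hu
  have hHu : ∀ i, schrodingerOp G W β u i = if i = φ then 1 else 0 := by
    intro i
    rw [hu, funext (greenM_root hG), schrodingerOp_add,
      schrodingerOp_green hG.connected hW hβ hlim,
      schrodingerOp_boundaryGreen hG hadj hW hβ hlim isTraceOf_univ, add_zero]
  have hupos : ∀ i, 0 < u i := fun i => by
    rw [hu, greenM_root hG]
    exact add_pos_of_pos_of_nonneg (green_root_pos hG.connected hW hβ hlim i)
      (boundaryGreen_nonneg hW hβ hlim hρ _ i)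
  have hr : IsWalkRate W u (rate G φ W β ρ φ) :=
    ⟨fun i => 1 / (2 * u i), fun i => one_div_pos.2 (mul_pos two_pos (hupos i)), fun i j => by
      have := (hupos i).ne'
      rw [rate, ← hu]
      field_simp⟩
  have hS := summable_walkOp_pow hW hadj hupos hr htrans φ
  have hgreen := tendsto_walkOp_pow_green_div hG.connected hadj hW hβ hlim hupos hHu hS
  set K := 1 / u φ + 1 / (u φ * adjSum G W u φ) *
    ∑' n, (walkOp G W u ^ n) (Set.indicator {φ} 1) φ with hK
  have hKpos : 0 < K := by
    have h1 : 0 ≤ ∑' n, (walkOp G W u ^ n) (Set.indicator {φ} 1) φ := tsum_nonneg fun n =>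
      walkOp_pow_nonneg hW hadj hupos (Set.indicator_nonneg fun _ _ => zero_le_one) n φ
    have h2 := adjSum_pos hW hadj hupos φ
    have h3 := hupos φ
    positivity
  have hexit : ∀ x, (exitMeasure G φ (rate G φ W β ρ φ) φ).real (endsThrough x) =
      boundaryGreen G φ W β ρ (endsThrough x) φ * K := by
    intro x
    have htr := isTraceOf_endsThrough hG φ x
    have h1 := tendsto_exitMeasure hG hW hadj hupos hr htrans htr φ
    set v := boundaryGreen G φ W β ρ (endsThrough x) with hv
    have h2 := tendsto_walkOp_pow_div hW hadj hupos hHu (f := v) (e := 0)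
      (fun i => by simpa using schrodingerOp_boundaryGreen hG hadj hW hβ hlim htr i) (hS φ)
    obtain ⟨C, hC⟩ := abs_indicator_sub_boundaryGreen_le hG hadj hW hβ hlim hρ x
    set I : V → ℝ := Set.indicator {y | IsAncestor G φ x y} 1 with hI
    have hdiff : ∀ j, |I j - v j / u j| ≤ C * (green G φ W β φ j / u j) := by
      intro j
      have hj := hupos j
      have : I j - v j / u j =
          (Set.indicator {y | IsAncestor G φ x y} u j - v j) / u j := by
        by_cases h : j ∈ {y | IsAncestor G φ x y}
        · simp only [hI, Set.indicator_of_mem h, Pi.one_apply]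
          field_simp
        · simp only [hI, Set.indicator_of_notMem h]
          ring
      rw [this, abs_div, abs_of_pos hj, ← mul_div_assoc]
      exact div_le_div_of_nonneg_right (hC j) hj.le
    have h3 : Tendsto (fun n => (walkOp G W u ^ n) I φ -
        (walkOp G W u ^ n) (fun j => v j / u j) φ) atTop (𝓝 0) := by
      refine squeeze_zero_norm (a := fun n => C *
        (walkOp G W u ^ n) (fun j => green G φ W β φ j / u j) φ) (fun n => ?_)
        (by simpa using hgreen.const_mul C)
      have hup := walkOp_pow_mono hW hadj hupos
        (g := I - fun j => v j / u j) (g' := C • fun j => green G φ W β φ j / u j)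
        (fun j => (abs_le.1 (hdiff j)).2) n φ
      have hlo := walkOp_pow_mono hW hadj hupos
        (g := -(C • fun j => green G φ W β φ j / u j)) (g' := I - fun j => v j / u j)
        (fun j => (abs_le.1 (hdiff j)).1) n φ
      rw [map_sub, map_smul] at hup
      rw [map_sub, map_neg, map_smul] at hlo
      exact abs_le.2 ⟨hlo, hup⟩
    have h4 := tendsto_nhds_unique (h1.sub h2) h3
    rw [sub_eq_zero] at h4
    rw [h4, hK]
    ring
  have hroot : (endsThrough φ : Set (Ends G φ)) = Set.univ :=
    Set.eq_univ_of_forall fun ω => ⟨0, ω.2.1⟩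
  have hone : boundaryGreen G φ W β ρ Set.univ φ * K = 1 := by
    rw [← hroot, ← hexit]
    refine tendsto_nhds_unique (tendsto_exitMeasure hG hW hadj hupos hr htrans
      (isTraceOf_endsThrough hG φ φ) φ) (tendsto_const_nhds.congr fun n => ?_)
    have : ({y | IsAncestor G φ φ y} : Set V) = Set.univ :=
      Set.eq_univ_of_forall fun y => isAncestor_root y
    rw [this, Set.indicator_univ, walkOp_pow_one hW hadj hupos]
    rfl
  have htotal : ∫ p, checkg G φ W β ρ p.1 p.2 ∂((chi G φ W β φ).prod (chi G φ W β φ)) =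
      boundaryGreen G φ W β ρ Set.univ φ := by
    rw [← setIntegral_checkg hG, Set.univ_prod_univ, Measure.restrict_univ]
  have hpos : 0 < boundaryGreen G φ W β ρ Set.univ φ :=
    pos_of_mul_pos_left (hone ▸ one_pos) hKpos.le
  refine ⟨integrable_checkg hG _ _, htotal ▸ hpos, fun x => ?_⟩
  rw [htotal, setIntegral_checkg hG, hexit, eq_div_iff hpos.ne', mul_assoc, mul_comm K, hone,
    mul_one]
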